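/- **Lemma (von Neumann Dimension Lemma).** Let $\Gamma$ be a countable discrete group and let $\sigma_i\colon\Gamma\to S_{d_i}$ ($i\in\mathbb N$) be a sofic approximation of $\Gamma$, i.e. $d_i\to\infty$ and $$\frac{|\{k:\sigma_i(g)\sigma_i(h)(k)=\sigma_i(gh)(k)\}|}{d_i}\to1\ \ (g,h\in\Gamma),\qquad \frac{|\{k:\sigma_i(g)(k)\ne\sigma_i(h)(k)\}|}{d_i}\to1\ \ (g\ne h\text{ in }\Gamma).$$ View $S_d$ inside $M_d(\mathbb R)$ as permutation matrices, $p\,e_k=e_{p(k)}$. Extend $\sigma_i$ to $\mathbb R(\Gamma)\to M_{d_i}(\mathbb R)$ by $\sigma_i(\alpha)=\sum_{g}\widehat\alpha(g)\sigma_i(g)$ for $\alpha=\sum_g\widehat\alpha(g)g$, and to $M_{n,m}(\mathbb R(\Gamma))\to M_{n,m}(M_{d_i}(\mathbb R))$ entrywise. Let $f\in M_{n,m}(\mathbb R(\Gamma))$. Let $(\rho(g)\xi)(x)=\xi(xg)$ be the right regular representation on $\ell^2(\Gamma)$, extended linearly to $\mathbb R(\Gamma)$, and let $\rho(f)\colon\ell^2(\Gamma)^{\oplus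 m}\to\ell^2(\Gamma)^{\oplus n}$ be $(\rho(f)\xi)_j=\sum_{l=1}^m\rho(f_{jl})\xi_l$. For a closed subspace $K\subseteq\ell^2(\Gamma)^{\oplus m}$ invariant under left translations, with orthogonal projection $P_K$, put $\dim_{R(\Gamma)}(K)=\sum_{j=1}^m\langle (P_K)_{jj}\delta_e,\delta_e\rangle$, where $(P_K)_{jj}$ is the $j$-th diagonal entry of $P_K$, viewed as an $m\times m$ matrix of operators on $\ell^2(\Gamma)$. On $\ell^2_{\mathbb R}(d,\mu_d)^{\oplus m}$ use the norm $\|\xi\|^2=\sum_{l=1}^m\frac1d\sum_{k=1}^d\xi_l(k)^2$, with closed unit ball $\mathrm{Ball}(\ell^2_{\mathbb R}(d,\mu_d)^{\oplus m})$. For $\varepsilon>0$ let $S_\varepsilon(X)$ be the smallest cardinality of a subset $A\subseteq X$ such that every point of $X$ is at distance less than $\varepsilon$ from $A$. Write $|T|=(T^*T)^{1/2}$, and let $\chi_{[0,\eta]}(|T|)$ be the orthogonal projection onto the sum of the eigenspaces of $|T|$ with eigenvalue in $[0,\eta]$. For $\varepsilon,\eta>0$ and $i\in\mathbb N$ put $$h_i(\varepsilon,\eta)=\frac{\log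 S_\varepsilon\big(\chi_{[0,\eta]}(|\sigma_i(f)|)\,\mathrm{Ball}(\ell^2_{\mathbb R}(d_i,\mu_{d_i})^{\oplus m})\big)}{d_i\log(1/\varepsilon)} .$$ Then the following five quantities are equal (infima over $\eta>0$, limits as $\varepsilon\to0^+$): 1. $\dim_{R(\Gamma)}(\ker\rho(f))$, 2. $\displaystyle\liminf_{\varepsilon\to0}\ \inf_{\eta}\ \liminf_{i\to\infty} h_i(\varepsilon,\eta)$, 3. $\displaystyle\limsup_{\varepsilon\to0}\ \inf_{\eta}\ \limsup_{i\to\infty} h_i(\varepsilon,\eta)$, 4. $\displaystyle\inf_{\eta}\ \liminf_{\varepsilon\to0}\ \liminf_{i\to\infty} h_i(\varepsilon,\eta)$, 5. $\displaystyle\inf_{\eta}\ \limsup_{\varepsilon\to0}\ \limsup_{i\to\infty} h_i(\varepsilon,\eta)$. -/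

import Mathlib

open Filter Topology
open scoped ENNReal InnerProductSpace

noncomputable section

namespace SoficDim

/-! ### Sofic approximations and the finite-dimensional models -/

/-- A sofic approximation of `Γ`: maps `σ i : Γ → S_{d i}`, with `d i → ∞`, which are asymptotically
multiplicative and asymptotically free with respect to the uniform probability measure on
`{1, …, d i}`. -/
structure IsSoficApprox {Γ : Type*} [Group Γ] (d : ℕ → ℕ)
    (σ : (i : ℕ) → Γ → Equiv.Perm (Fin (d i))) : Prop where
  tendsto_atTop : Tendsto d atTop atTop
  mul : ∀ g h : Γ, Tendsto
    (fun i => ((Finset.univ.filter fun k => σ i g (σ i h k) = σ i (g * h) k).card : ℝ) / (d i : ℝ))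
    atTop (𝓝 1)
  free : ∀ g h : Γ, g ≠ h → Tendsto
    (fun i => ((Finset.univ.filter fun k => σ i g k ≠ σ i h k).card : ℝ) / (d i : ℝ))
    atTop (𝓝 1)

/-- The permutation matrix of `p`, acting on column vectors by `e_k ↦ e_{p k}`; thus `p ↦ permMat p`
is multiplicative. -/
def permMat {d : ℕ} (p : Equiv.Perm (Fin d)) : Matrix (Fin d) (Fin d) ℝ :=
  Matrix.of fun j k => if p k = j then 1 else 0

/-- The extension `σ(f) = ∑_g f(g) σ(g)` of a map `σ : Γ → S_d` to the real group ring. -/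
def extend {Γ : Type*} [Group Γ] {d : ℕ} (σ : Γ → Equiv.Perm (Fin d))
    (f : MonoidAlgebra ℝ Γ) : Matrix (Fin d) (Fin d) ℝ :=
  ∑ g ∈ f.coeff.support, f.coeff g • permMat (σ g)

/-- The entrywise extension to rectangular matrices over the real group ring, `σ(f)_{jk} = σ(f_{jk})`,
where an `n × m` matrix of `d × d` blocks is regarded as one real matrix. -/
def extendMat {Γ : Type*} [Group Γ] {d n m : ℕ} (σ : Γ → Equiv.Perm (Fin d))
    (f : Matrix (Fin n) (Fin m) (MonoidAlgebra ℝ Γ)) :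
    Matrix (Fin n × Fin d) (Fin m × Fin d) ℝ :=
  Matrix.comp (Fin n) (Fin m) (Fin d) (Fin d) ℝ (f.map (extend σ))

/-- The absolute value `|A| = (Aᵀ A)^{1/2}` of a real rectangular matrix, by functional calculus. -/
def matAbs {p q : Type*} [Fintype p] [Fintype q] [DecidableEq q] (A : Matrix p q ℝ) :
    Matrix q q ℝ :=
  cfc Real.sqrt (A.transpose * A)

/-- The spectral projection `χ_{[0,η]}(T)` of a symmetric real matrix, by functional calculus (every
function on the finite spectrum of `T` is continuous). -/
def specProj {q : Type*} [Fintype q] [DecidableEq q] (η : ℝ) (T : Matrix q q ℝ) : Matrix q q ℝ :=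
  cfc (Set.indicator (Set.Icc 0 η) (fun _ => (1 : ℝ))) T

/-- The norm of `ℓ²_ℝ(d, μ_d)^{⊕m}`, where `μ_d` is the uniform probability measure on `d` points:
`‖ξ‖² = ∑_l (1/d) ∑_k ξ_l(k)²`. -/
def l2Norm {m d : ℕ} (ξ : Fin m × Fin d → ℝ) : ℝ :=
  Real.sqrt (∑ l : Fin m, (∑ k : Fin d, ξ (l, k) ^ 2) / (d : ℝ))

/-- The closed unit ball of `ℓ²_ℝ(d, μ_d)^{⊕m}`. -/
def l2Ball (m d : ℕ) : Set (Fin m × Fin d → ℝ) := {ξ | l2Norm ξ ≤ 1}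

/-! ### Covering numbers -/

/-- `A` is an `ε`-dense subset of `X` for the pseudometric `ρ`: `A ⊆ X`, and `X` is contained in the
`ε`-neighbourhood of `A`. -/
def IsDenseIn {α : Type*} (ρ : α → α → ℝ) (ε : ℝ) (X A : Set α) : Prop :=
  A ⊆ X ∧ ∀ x ∈ X, ∃ a ∈ A, ρ x a < ε

/-- The smallest cardinality of an `ε`-dense subset of `X` (used for totally bounded `X`, where
finite `ε`-dense subsets exist). -/
def coveringNum {α : Type*} (ρ : α → α → ℝ) (ε : ℝ) (X : Set α) : ℕ :=
  sInf {N | ∃ A : Finset α, IsDenseIn ρ ε X A ∧ A.card = N}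

/-- The covering numbers used below are those of totally bounded sets, so they are not infima over
the empty set. -/
theorem exists_isDenseIn {m d : ℕ} (P : Matrix (Fin m × Fin d) (Fin m × Fin d) ℝ) {ε : ℝ}
    (hε : 0 < ε) : ∃ A : Finset (Fin m × Fin d → ℝ),
      IsDenseIn (fun ξ ζ => l2Norm (ξ - ζ)) ε (P.mulVec '' l2Ball m d) A := by
  classical
  have hc : Continuous (l2Norm : (Fin m × Fin d → ℝ) → ℝ) := by
    unfold l2Norm
    fun_prop
  have hb : IsCompact (l2Ball m d) := by
    refine Metric.isCompact_of_isClosed_isBounded (isClosed_le hc continuous_const) ?_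
    refine (Metric.isBounded_iff_subset_closedBall 0).2 ⟨Real.sqrt d, fun ξ hξ => ?_⟩
    rw [mem_closedBall_zero_iff, pi_norm_le_iff_of_nonneg (Real.sqrt_nonneg _)]
    rintro ⟨l, k⟩
    have hd : (0 : ℝ) < d := by
      have : 0 < d := k.pos
      exact_mod_cast this
    have h1 : (∑ l : Fin m, (∑ k : Fin d, ξ (l, k) ^ 2) / (d : ℝ)) ≤ 1 := by
      have : l2Norm ξ ≤ 1 := hξ
      unfold l2Norm at this
      exact Real.sqrt_le_one.1 this
    have h2 : ξ (l, k) ^ 2 ≤ ∑ k : Fin d, ξ (l, k) ^ 2 :=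
      Finset.single_le_sum (f := fun k => ξ (l, k) ^ 2) (fun _ _ => sq_nonneg _)
        (Finset.mem_univ k)
    have h3 : (∑ k : Fin d, ξ (l, k) ^ 2) / (d : ℝ) ≤
        ∑ l : Fin m, (∑ k : Fin d, ξ (l, k) ^ 2) / (d : ℝ) :=
      Finset.single_le_sum (f := fun l => (∑ k : Fin d, ξ (l, k) ^ 2) / (d : ℝ))
        (fun _ _ => div_nonneg (Finset.sum_nonneg fun _ _ => sq_nonneg _) hd.le)
        (Finset.mem_univ l)
    have h4 := h3.trans h1
    rw [div_le_one hd] at h4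
    rw [Real.norm_eq_abs]
    exact Real.abs_le_sqrt (h2.trans h4)
  have hK : IsCompact (P.mulVec '' l2Ball m d) :=
    hb.image (Continuous.matrix_mulVec continuous_const continuous_id)
  obtain ⟨t, ht, hcov⟩ := hK.elim_nhds_subcover (fun a => {x | l2Norm (x - a) < ε}) (by
    intro a _
    refine (isOpen_lt (hc.comp (continuous_id.sub continuous_const)) continuous_const).mem_nhds ?_
    simp [l2Norm, hε])
  refine ⟨t, fun a ha => ht a ha, fun x hx => ?_⟩
  obtain ⟨a, ha, hxa⟩ := Set.mem_iUnion₂.1 (hcov hx)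
  exact ⟨a, ha, hxa⟩

/-- The normalised exponential growth rate
`log S_ε(χ_{[0,η]}(|σ(f)|) Ball(ℓ²_ℝ(d, μ_d)^{⊕m})) / (d log(1/ε))`. -/
def growth {Γ : Type*} [Group Γ] {d n m : ℕ} (σ : Γ → Equiv.Perm (Fin d))
    (f : Matrix (Fin n) (Fin m) (MonoidAlgebra ℝ Γ)) (ε η : ℝ) : ℝ :=
  Real.log (coveringNum (fun ξ ζ => l2Norm (ξ - ζ)) ε
    ((specProj η (matAbs (extendMat σ f))).mulVec '' l2Ball m d)) / ((d : ℝ) * Real.log (1 / ε))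

/-! ### The right regular representation and von Neumann dimension -/

/-- The complex Hilbert space `ℓ²(Γ)`. -/
abbrev Ell2 (Γ : Type*) := lp (fun _ : Γ => ℂ) 2

/-- The Hilbert space `ℓ²(Γ)^{⊕m}`. -/
abbrev Ell2Sum (Γ : Type*) (m : ℕ) := PiLp 2 (fun _ : Fin m => Ell2 Γ)

/-- The right regular representation, `(ρ(g)ξ)(x) = ξ(xg)`. -/
def rightReg {Γ : Type*} [Group Γ] (g : Γ) : Ell2 Γ →L[ℂ] Ell2 Γ :=
  LinearIsometry.toContinuousLinearMap
    { toFun := fun ξ => ⟨fun x => ξ (x * g), by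
        have h := (memℓp_gen_iff (p := 2) (by norm_num)).1 (lp.memℓp ξ)
        exact memℓp_gen ((Equiv.mulRight g).summable_iff.2 h)⟩
      map_add' := fun _ _ => rfl
      map_smul' := fun _ _ => rfl
      norm_map' := fun ξ => by
        rw [lp.norm_eq_tsum_rpow (by norm_num), lp.norm_eq_tsum_rpow (by norm_num)]
        congr 1
        exact (Equiv.mulRight g).tsum_eq (fun x => ‖ξ x‖ ^ (2 : ℝ≥0∞).toReal) }

/-- The extension `ρ(f) = ∑_g f(g) ρ(g)` of the right regular representation to the real group
ring. -/
def rightRegAlg {Γ : Type*} [Group Γ] (f : MonoidAlgebra ℝ Γ) : Ell2 Γ →L[ℂ] Ell2 Γ :=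
  ∑ g ∈ f.coeff.support, (f.coeff g : ℂ) • rightReg g

/-- The operator `ρ(f) : ℓ²(Γ)^{⊕m} → ℓ²(Γ)^{⊕n}` of an `n × m` matrix over the real group ring,
`(ρ(f)ξ)(j) = ∑_l ρ(f_{jl}) ξ_l`. -/
def rightRegMat {Γ : Type*} [Group Γ] {n m : ℕ} (f : Matrix (Fin n) (Fin m) (MonoidAlgebra ℝ Γ)) :
    Ell2Sum Γ m →L[ℂ] Ell2Sum Γ n :=
  (PiLp.continuousLinearEquiv 2 ℂ (fun _ : Fin n => Ell2 Γ)).symm.toContinuousLinearMap.comp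
    (ContinuousLinearMap.pi fun j : Fin n =>
      ∑ l : Fin m, (rightRegAlg (f j l)).comp (PiLp.proj 2 (fun _ : Fin m => Ell2 Γ) l))

open Classical in
/-- The unit vector `δ_e` of `ℓ²(Γ)`. -/
def deltaOne (Γ : Type*) [Group Γ] : Ell2 Γ := lp.single 2 (1 : Γ) (1 : ℂ)

/-- The matrix entry `T_{jk} ∈ B(ℓ²(Γ))` of an operator `T` on `ℓ²(Γ)^{⊕m}`. -/
def opEntry {Γ : Type*} {m : ℕ} (T : Ell2Sum Γ m →L[ℂ] Ell2Sum Γ m) (j k : Fin m) (ξ : Ell2 Γ) :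
    Ell2 Γ :=
  T (WithLp.toLp 2 (Pi.single k ξ)) j

/-- `(Tr ⊗ τ)(T) = ∑_j τ(T_{jj})`, where `τ(x) = ⟨x δ_e, δ_e⟩` (linear in the first slot; Mathlib's
inner product is linear in the second one). -/
def vnTrace {Γ : Type*} [Group Γ] {m : ℕ} (T : Ell2Sum Γ m →L[ℂ] Ell2Sum Γ m) : ℂ :=
  ∑ j : Fin m, ⟪deltaOne Γ, opEntry T j j (deltaOne Γ)⟫_ℂ

/-- The Murray–von Neumann dimension `dim_{R(Γ)}(K) = (Tr ⊗ τ)(P_K)` of a closed subspace `K` of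
`ℓ²(Γ)^{⊕m}` invariant under left translations, `P_K` being the orthogonal projection onto `K`.
(The trace of a projection is a nonnegative real number.) -/
def vnDim {Γ : Type*} [Group Γ] {m : ℕ} (K : Submodule ℂ (Ell2Sum Γ m))
    [K.HasOrthogonalProjection] : ℝ :=
  (vnTrace K.starProjection).re

end SoficDim

end

/-! The image of the unit ball under a spectral projection of rank `r` is the ball of an
`r`-dimensional Euclidean space, so a volume argument puts its covering number between `ε⁻ʳ` and `(1
+ 2/ε)ʳ`. Hence the growth rate lies between `r/d` and `r/d + m log 3 / log (1/ε)`
(`specRank_div_le_growth`, `growth_le`). The error vanishes as `ε → 0`, uniformly in `i` and `η`,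
and only the normalized ranks `specRank / d` have to be compared with `D = dim ker ρ(f)`.

The ranks are controlled by moments. Let `C` bound the spectra of all `σ_i(f)ᵀ σ_i(f)` and also
`‖ρ(f)‖²`. On `[0, C]` the functions `(1 - t/C)^k` compare from both sides with the indicator of `√t
≤ η` (`trace_pow_le_specRank`, `specRank_mul_le_trace_pow`). Soficity makes the normalized traces of
`(1 - C⁻¹ σ_i(f)ᵀ σ_i(f))^k` converge to the von Neumann trace of `(1 - C⁻¹ ρ(f)* ρ(f))^k`
(`IsSoficApprox.tendsto_trace_pow`). These limits decrease in `k`. By the mean ergodic theorem their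
Cesàro means tend to the dimension of the fixed space of the contraction `1 - C⁻¹ ρ(f)* ρ(f)`, which
is `ker ρ(f)`; so the moments themselves tend to `D` (`IsSoficApprox.tendsto_moment`).

For fixed `η`, a large `k` gives `specRank / d ≥ D - δ` eventually in `i`; for fixed large `k`, a
small `η` gives `specRank / d ≤ D + δ`. These two bounds pinch all four iterated limits
(`iterated_limits_eq`). -/

noncomputable section

namespace SoficDim

/-! ### Covering numbers of balls in finite-dimensional spaces -/

open MeasureTheory in
/-- A cover of the unit ball of an `r`-dimensional space by `ε`-balls has at least `ε⁻ʳ` members. -/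
theorem one_le_card_mul_pow_of_cover {E : Type*} [NormedAddCommGroup E] [NormedSpace ℝ E]
    [FiniteDimensional ℝ E] {ε : ℝ} (hε : 0 < ε) (A : Finset E)
    (hA : ∀ x : E, ‖x‖ ≤ 1 → ∃ a ∈ A, ‖x - a‖ < ε) :
    1 ≤ (A.card : ℝ) * ε ^ Module.finrank ℝ E := by
  borelize E
  let μ : Measure E := Measure.addHaar
  have hpos : 0 < μ (Metric.ball 0 1) := Metric.measure_ball_pos _ _ one_pos
  have hfin : μ (Metric.ball 0 1) ≠ ⊤ := measure_ball_lt_top.ne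
  have h1 : μ (Metric.ball 0 1) ≤ ∑ a ∈ A, μ (Metric.ball a ε) := by
    refine (measure_mono ?_).trans (measure_biUnion_finset_le A _)
    intro x hx
    obtain ⟨a, ha, h⟩ := hA x (by simpa using (mem_ball_zero_iff.1 hx).le)
    exact Set.mem_iUnion₂.2 ⟨a, ha, by simpa [dist_eq_norm] using h⟩
  simp_rw [μ.addHaar_ball_of_pos _ hε] at h1
  rw [Finset.sum_const, nsmul_eq_mul, ← mul_assoc] at h1
  have h2 : (1 : ℝ≥0∞) ≤ (A.card : ℝ≥0∞) * ENNReal.ofReal (ε ^ Module.finrank ℝ E) := by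
    by_contra! h
    have := ENNReal.mul_lt_mul_left hpos.ne' hfin h
    rw [one_mul] at this
    exact absurd h1 (not_le.2 this)
  rw [← ENNReal.ofReal_natCast, ← ENNReal.ofReal_mul (by positivity)] at h2
  exact ENNReal.one_le_ofReal.1 h2

-- The balls of radius `ε/2` about the points are disjoint and lie in the ball of radius `1 + ε/2`;
-- comparing Haar measures gives the bound.
open MeasureTheory in
theorem card_le_of_separated {E : Type*} [NormedAddCommGroup E] [NormedSpace ℝ E]
    [FiniteDimensional ℝ E] {ε : ℝ} (hε : 0 < ε) (A : Finset E) (hA : ∀ x ∈ A, ‖x‖ ≤ 1)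
    (hs : ∀ x ∈ A, ∀ y ∈ A, x ≠ y → ε ≤ ‖x - y‖) :
    (A.card : ℝ) ≤ (1 + 2 / ε) ^ Module.finrank ℝ E := by
  borelize E
  let μ : Measure E := Measure.addHaar
  have hpos : 0 < μ (Metric.ball 0 1) := Metric.measure_ball_pos _ _ one_pos
  have hfin : μ (Metric.ball 0 1) ≠ ⊤ := measure_ball_lt_top.ne
  have h1 : ∑ a ∈ A, μ (Metric.ball a (ε / 2)) ≤ μ (Metric.ball 0 (1 + ε / 2)) := by
    rw [← measure_biUnion_finset ?_ fun _ _ => Metric.isOpen_ball.measurableSet]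
    · refine measure_mono (Set.iUnion₂_subset fun a ha x hx => ?_)
      rw [mem_ball_zero_iff]
      rw [Metric.mem_ball, dist_eq_norm] at hx
      have := norm_add_le (x - a) a
      rw [sub_add_cancel] at this
      linarith [hA a ha]
    · intro x hx y hy hxy
      refine Metric.ball_disjoint_ball ?_
      rw [dist_eq_norm]
      linarith [hs x hx y hy hxy]
  simp_rw [μ.addHaar_ball_of_pos _ (half_pos hε)] at h1
  rw [μ.addHaar_ball_of_pos _ (show 0 < 1 + ε / 2 by positivity), Finset.sum_const,
    nsmul_eq_mul, ← mul_assoc] at h1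
  have h2 := (ENNReal.mul_le_mul_iff_left hpos.ne' hfin).1 h1
  rw [← ENNReal.ofReal_natCast, ← ENNReal.ofReal_mul (by positivity),
    ENNReal.ofReal_le_ofReal_iff (by positivity)] at h2
  have h3 : (1 + 2 / ε) = (1 + ε / 2) / (ε / 2) := by field_simp; ring
  rw [h3, div_pow, le_div_iff₀ (by positivity)]
  exact h2

/-- The unit ball of an `r`-dimensional space has an `ε`-dense subset with at most `(1 + 2/ε)ʳ`
members. -/
theorem exists_cover_card_le {E : Type*} [NormedAddCommGroup E] [NormedSpace ℝ E]
    [FiniteDimensional ℝ E] {ε : ℝ} (hε : 0 < ε) :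
    ∃ A : Finset E, (∀ x ∈ A, ‖x‖ ≤ 1) ∧ (∀ x : E, ‖x‖ ≤ 1 → ∃ a ∈ A, ‖x - a‖ < ε) ∧
      (A.card : ℝ) ≤ (1 + 2 / ε) ^ Module.finrank ℝ E := by
  classical
  let p : ℕ → Prop := fun k => ∃ A : Finset E, (∀ x ∈ A, ‖x‖ ≤ 1) ∧
    (∀ x ∈ A, ∀ y ∈ A, x ≠ y → ε ≤ ‖x - y‖) ∧ A.card = k
  have hb : ∀ k, p k → k ≤ ⌊(1 + 2 / ε) ^ Module.finrank ℝ E⌋₊ := by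
    rintro k ⟨A, h1, h2, rfl⟩
    exact Nat.le_floor (card_le_of_separated hε A h1 h2)
  have h0 : p 0 := ⟨∅, by simp, by simp, rfl⟩
  -- A separated subset of maximal cardinality is `ε`-dense: a point that it misses could be added
  -- to it.
  obtain ⟨A, h1, h2, h3⟩ := Nat.findGreatest_spec (P := p)
    (Nat.zero_le ⌊(1 + 2 / ε) ^ Module.finrank ℝ E⌋₊) h0
  refine ⟨A, h1, fun x hx => ?_, card_le_of_separated hε A h1 h2⟩
  by_contra! hcon
  have hxA : x ∉ A := fun h => by
    have := hcon x h
    simp at this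
    linarith
  have hp : p (insert x A).card := by
    refine ⟨insert x A, ?_, ?_, rfl⟩
    · intro y hy
      rcases Finset.mem_insert.1 hy with rfl | hy
      exacts [hx, h1 y hy]
    · intro y hy z hz hyz
      rcases Finset.mem_insert.1 hy with hy' | hy' <;> rcases Finset.mem_insert.1 hz with hz' | hz'
      · exact absurd (hy'.trans hz'.symm) hyz
      · exact hy' ▸ hcon z hz'
      · rw [norm_sub_rev]; exact hz' ▸ hcon y hy'
      · exact h2 y hy' z hz' hyz
  have h4 := Nat.le_findGreatest (hb _ hp) hp
  rw [Finset.card_insert_of_notMem hxA, ← h3] at h4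
  omega

theorem l2Norm_eq {m d : ℕ} (ξ : Fin m × Fin d → ℝ) :
    l2Norm ξ = ‖WithLp.toLp 2 ξ‖ / Real.sqrt d := by
  rw [l2Norm, EuclideanSpace.norm_eq, ← Real.sqrt_div (by positivity), ← Finset.sum_div,
    Fintype.sum_prod_type]
  simp

/-- The range of a square matrix, as a subspace of Euclidean space. -/
def euclRange {q : Type*} [Fintype q] [DecidableEq q] (P : Matrix q q ℝ) :
    Submodule ℝ (EuclideanSpace ℝ q) :=
  LinearMap.range (Matrix.toEuclideanLin P)

/-- An idempotent contraction sends the ball onto the intersection of the ball with its range. The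
radius is `√d` because `l2Norm` is the Euclidean norm divided by `√d`. -/
theorem mem_image_l2Ball_iff {m d : ℕ} (hd : 0 < d)
    (P : Matrix (Fin m × Fin d) (Fin m × Fin d) ℝ) (hP : P * P = P)
    (hc : ∀ v, ‖WithLp.toLp 2 (P.mulVec v)‖ ≤ ‖WithLp.toLp 2 v‖) (ξ : Fin m × Fin d → ℝ) :
    ξ ∈ P.mulVec '' l2Ball m d ↔
      WithLp.toLp 2 ξ ∈ euclRange P ∧ ‖WithLp.toLp 2 ξ‖ ≤ Real.sqrt d := by
  have hs : 0 < Real.sqrt d := Real.sqrt_pos.2 (by exact_mod_cast hd)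
  constructor
  · rintro ⟨v, hv, rfl⟩
    refine ⟨⟨WithLp.toLp 2 v, by simp [Matrix.toLpLin_apply]⟩, (hc v).trans ?_⟩
    have : l2Norm v ≤ 1 := hv
    rwa [l2Norm_eq, div_le_one hs] at this
  · rintro ⟨⟨w, hw⟩, h2⟩
    refine ⟨ξ, ?_, ?_⟩
    · show l2Norm ξ ≤ 1
      rwa [l2Norm_eq, div_le_one hs]
    · have : ξ = P.mulVec w.ofLp := by
        have := congrArg WithLp.ofLp hw
        simpa [Matrix.toLpLin_apply] using this.symm
      rw [this, Matrix.mulVec_mulVec, hP]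

theorem coveringNum_le_of_isDenseIn {α : Type*} {ρ : α → α → ℝ} {ε : ℝ} {X : Set α}
    {A : Finset α} (h : IsDenseIn ρ ε X A) : coveringNum ρ ε X ≤ A.card :=
  Nat.sInf_le ⟨A, h, rfl⟩

theorem one_le_coveringNum_mul_pow {m d : ℕ} (hd : 0 < d)
    (P : Matrix (Fin m × Fin d) (Fin m × Fin d) ℝ) (hP : P * P = P)
    (hc : ∀ v, ‖WithLp.toLp 2 (P.mulVec v)‖ ≤ ‖WithLp.toLp 2 v‖) {ε : ℝ} (hε : 0 < ε) :
    1 ≤ (coveringNum (fun ξ ζ => l2Norm (ξ - ζ)) ε (P.mulVec '' l2Ball m d) : ℝ) *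
      ε ^ Module.finrank ℝ (euclRange P) := by
  classical
  have hs : 0 < Real.sqrt d := Real.sqrt_pos.2 (by exact_mod_cast hd)
  -- Needed because `sInf ∅ = 0` in `ℕ` would falsify a lower bound.
  have hne : {N | ∃ A : Finset (Fin m × Fin d → ℝ), IsDenseIn (fun ξ ζ => l2Norm (ξ - ζ)) ε
      (P.mulVec '' l2Ball m d) A ∧ A.card = N}.Nonempty := by
    obtain ⟨A, hA⟩ := exists_isDenseIn (m := m) P hε
    exact ⟨_, A, hA, rfl⟩
  obtain ⟨A, ⟨hAX, hA⟩, hcard⟩ := Nat.sInf_mem hne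
  have hcard' : A.card = coveringNum (fun ξ ζ => l2Norm (ξ - ζ)) ε (P.mulVec '' l2Ball m d) := hcard
  rw [← hcard']
  -- Dividing by `√d` turns an `ε`-dense set for `l2Norm` into one for the Euclidean unit ball of
  -- the range.
  let φ : A → euclRange P := fun a =>
    ⟨(Real.sqrt d)⁻¹ • WithLp.toLp 2 (a : Fin m × Fin d → ℝ), Submodule.smul_mem _ _
      ((mem_image_l2Ball_iff hd P hP hc _).1 (hAX a.2)).1⟩
  have h := one_le_card_mul_pow_of_cover hε (Finset.univ.image φ) fun x hx => ?_
  · refine h.trans (mul_le_mul_of_nonneg_right ?_ (by positivity))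
    have : (Finset.univ.image φ).card ≤ A.card := Finset.card_image_le.trans (by simp)
    exact_mod_cast this
  · have hxX : WithLp.ofLp (Real.sqrt d • (x : EuclideanSpace ℝ (Fin m × Fin d))) ∈
        P.mulVec '' l2Ball m d := by
      rw [mem_image_l2Ball_iff hd P hP hc]
      refine ⟨Submodule.smul_mem _ _ x.2, ?_⟩
      rw [WithLp.toLp_ofLp, norm_smul, Real.norm_of_nonneg hs.le]
      exact mul_le_of_le_one_right hs.le hx
    obtain ⟨a, ha, hxa⟩ := hA _ hxX
    refine ⟨φ ⟨a, ha⟩, by simp, ?_⟩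
    replace hxa : l2Norm _ < ε := hxa
    rw [l2Norm_eq, div_lt_iff₀ hs] at hxa
    have : (x - φ ⟨a, ha⟩ : EuclideanSpace ℝ (Fin m × Fin d)) = (Real.sqrt d)⁻¹ •
        (WithLp.toLp 2 (WithLp.ofLp (Real.sqrt d • (x : EuclideanSpace ℝ (Fin m × Fin d))) - a)) := by
      rw [WithLp.toLp_sub, WithLp.toLp_ofLp, smul_sub, smul_smul, inv_mul_cancel₀ hs.ne', one_smul]
    rw [Submodule.coe_norm, Submodule.coe_sub, this, norm_smul, norm_inv,
      Real.norm_of_nonneg hs.le, inv_mul_lt_iff₀ hs, mul_comm]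
    exact hxa

theorem coveringNum_le_pow {m d : ℕ} (hd : 0 < d)
    (P : Matrix (Fin m × Fin d) (Fin m × Fin d) ℝ) (hP : P * P = P)
    (hc : ∀ v, ‖WithLp.toLp 2 (P.mulVec v)‖ ≤ ‖WithLp.toLp 2 v‖) {ε : ℝ} (hε : 0 < ε) :
    (coveringNum (fun ξ ζ => l2Norm (ξ - ζ)) ε (P.mulVec '' l2Ball m d) : ℝ) ≤
      (1 + 2 / ε) ^ Module.finrank ℝ (euclRange P) := by
  classical
  have hs : 0 < Real.sqrt d := Real.sqrt_pos.2 (by exact_mod_cast hd)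
  obtain ⟨A, hA1, hA2, hA3⟩ := exists_cover_card_le (E := euclRange P) hε
  let ψ : euclRange P → (Fin m × Fin d → ℝ) := fun x =>
    WithLp.ofLp (Real.sqrt d • (x : EuclideanSpace ℝ (Fin m × Fin d)))
  have hden : IsDenseIn (fun ξ ζ => l2Norm (ξ - ζ)) ε (P.mulVec '' l2Ball m d)
      (A.image ψ : Finset _) := by
    constructor
    · intro y hy
      obtain ⟨x, hx, rfl⟩ := Finset.mem_image.1 (Finset.mem_coe.1 hy)
      rw [mem_image_l2Ball_iff hd P hP hc]
      refine ⟨Submodule.smul_mem _ _ x.2, ?_⟩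
      rw [WithLp.toLp_ofLp, norm_smul, Real.norm_of_nonneg hs.le]
      exact mul_le_of_le_one_right hs.le (hA1 x hx)
    · intro y hy
      obtain ⟨h1, h2⟩ := (mem_image_l2Ball_iff hd P hP hc _).1 hy
      obtain ⟨a, ha, hlt⟩ := hA2 ⟨(Real.sqrt d)⁻¹ • WithLp.toLp 2 y, Submodule.smul_mem _ _ h1⟩ (by
        rw [Submodule.coe_norm, norm_smul, norm_inv, Real.norm_of_nonneg hs.le,
          inv_mul_le_iff₀ hs, mul_one]
        exact h2)
      refine ⟨ψ a, Finset.mem_coe.2 (Finset.mem_image_of_mem _ ha), ?_⟩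
      have : WithLp.toLp 2 (y - ψ a) = Real.sqrt d • ((Real.sqrt d)⁻¹ • WithLp.toLp 2 y -
          (a : EuclideanSpace ℝ (Fin m × Fin d))) := by
        rw [smul_sub, smul_smul, mul_inv_cancel₀ hs.ne', one_smul]
        rfl
      show l2Norm _ < ε
      rw [l2Norm_eq, div_lt_iff₀ hs, this, norm_smul, Real.norm_of_nonneg hs.le, mul_comm]
      exact mul_lt_mul_of_pos_right hlt hs
  refine le_trans ?_ hA3
  exact_mod_cast (coveringNum_le_of_isDenseIn hden).trans Finset.card_image_le

/-! ### Spectral ranks and traces of powers -/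

theorem posSemidef_gram {p q : Type*} [Fintype p] [Fintype q] (A : Matrix p q ℝ) :
    (A.transpose * A).PosSemidef := by
  simpa using Matrix.posSemidef_conjTranspose_mul_self A

section Spectral

variable {p q : Type*} [Fintype p] [Fintype q] [DecidableEq q]

theorem trace_cfc {T : Matrix q q ℝ} (hT : T.IsHermitian) (g : ℝ → ℝ) :
    (cfc g T).trace = ∑ j, g (hT.eigenvalues j) := by
  rw [hT.cfc_eq g, Matrix.IsHermitian.cfc, Unitary.conjStarAlgAut_apply, Matrix.trace_mul_comm,
    ← mul_assoc]
  simp [Matrix.trace]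

/-- Gershgorin: the eigenvalue differs from some diagonal entry `T k k` by at most the off-diagonal
absolute sum of row `k`. -/
theorem abs_eigenvalues_le {T : Matrix q q ℝ} (hT : T.IsHermitian) {C : ℝ}
    (hC : ∀ i, ∑ j, |T i j| ≤ C) (j : q) : |hT.eigenvalues j| ≤ C := by
  have h1 : Module.End.HasEigenvalue (Matrix.toLin' T) (hT.eigenvalues j) := by
    rw [Module.End.hasEigenvalue_iff_mem_spectrum, Matrix.spectrum_toLin']
    exact hT.eigenvalues_mem_spectrum_real j
  obtain ⟨k, hk⟩ := eigenvalue_mem_ball h1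
  rw [Metric.mem_closedBall, dist_eq_norm, Real.norm_eq_abs] at hk
  have h2 := abs_add_le (hT.eigenvalues j - T k k) (T k k)
  rw [sub_add_cancel] at h2
  have h3 := Finset.add_sum_erase Finset.univ (fun j => |T k j|) (Finset.mem_univ k)
  have h4 := hC k
  simp only [Real.norm_eq_abs] at hk
  linarith

/-- The indicator of `{t : √t ≤ η}`. -/
def cutoff (η t : ℝ) : ℝ := (Set.Icc 0 η).indicator (fun _ => (1 : ℝ)) (Real.sqrt t)

theorem cutoff_mul_self (η t : ℝ) : cutoff η t * cutoff η t = cutoff η t := by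
  unfold cutoff
  by_cases h : Real.sqrt t ∈ Set.Icc 0 η <;> simp [h]

/-- This removes the square root, leaving a function of the Gram matrix, whose polynomial traces can
be computed. Continuity is automatic on a finite spectrum. -/
theorem specProj_matAbs (A : Matrix p q ℝ) (η : ℝ) :
    specProj η (matAbs A) = cfc (cutoff η) (A.transpose * A) := by
  have hT : IsSelfAdjoint (A.transpose * A) := (posSemidef_gram A).1
  have hf : (spectrum ℝ (A.transpose * A)).Finite := Matrix.finite_real_spectrum
  exact (cfc_comp _ _ _ hT ((hf.image _).continuousOn _) (hf.continuousOn _)).symm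

theorem specProj_mul_self (A : Matrix p q ℝ) (η : ℝ) :
    specProj η (matAbs A) * specProj η (matAbs A) = specProj η (matAbs A) := by
  have hf : (spectrum ℝ (A.transpose * A)).Finite := Matrix.finite_real_spectrum
  rw [specProj_matAbs, ← cfc_mul _ _ _ (hf.continuousOn _) (hf.continuousOn _)]
  simp_rw [cutoff_mul_self]

theorem norm_mulVec_le_of_idempotent {P : Matrix q q ℝ} (hP : P * P = P) (hs : P.IsHermitian)
    (v : q → ℝ) : ‖WithLp.toLp 2 (P.mulVec v)‖ ≤ ‖WithLp.toLp 2 v‖ := by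
  have hsym := Matrix.isSymmetric_toEuclideanLin_iff.2 hs
  have h1 : ‖WithLp.toLp 2 (P.mulVec v)‖ ^ 2 ≤
      ‖WithLp.toLp 2 v‖ * ‖WithLp.toLp 2 (P.mulVec v)‖ := by
    have h2 := hsym (WithLp.toLp 2 v) (WithLp.toLp 2 (P.mulVec v))
    simp only [Matrix.toLpLin_apply, Matrix.mulVec_mulVec, hP] at h2
    rw [← real_inner_self_eq_norm_sq, h2]
    exact real_inner_le_norm _ _
  by_contra! h
  nlinarith [norm_nonneg (WithLp.toLp 2 v)]

theorem finrank_euclRange_eq_trace {P : Matrix q q ℝ} (hP : P * P = P) :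
    (Module.finrank ℝ (euclRange P) : ℝ) = P.trace := by
  have h : LinearMap.IsProj (euclRange P) (Matrix.toEuclideanLin P) := by
    refine ⟨fun x => ⟨x, rfl⟩, ?_⟩
    rintro _ ⟨x, rfl⟩
    simp [Matrix.toLpLin_apply, Matrix.mulVec_mulVec, hP]
  rw [← h.trace, Matrix.toEuclideanLin, Matrix.toLpLin_eq_toLin,
    LinearMap.trace_eq_matrix_trace ℝ (PiLp.basisFun 2 ℝ q),
    LinearMap.toMatrix_toLin]

theorem trace_one_sub_smul_pow (A : Matrix p q ℝ) (c : ℝ) (k : ℕ) :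
    ((1 - c • (A.transpose * A)) ^ k).trace =
      ∑ j, (1 - c * (posSemidef_gram A).1.eigenvalues j) ^ k := by
  have hT : IsSelfAdjoint (A.transpose * A) := (posSemidef_gram A).1
  rw [← trace_cfc (posSemidef_gram A).1 (fun t => (1 - c * t) ^ k), cfc_pow .., cfc_sub ..,
    cfc_const_one .., cfc_const_mul_id ..]

/-- The dimension of the spectral subspace of `|A|` for `[0, η]`. -/
def specRank (A : Matrix p q ℝ) (η : ℝ) : ℕ :=
  Module.finrank ℝ (euclRange (specProj η (matAbs A)))

theorem specRank_eq (A : Matrix p q ℝ) (η : ℝ) :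
    (specRank A η : ℝ) = ∑ j, cutoff η ((posSemidef_gram A).1.eigenvalues j) := by
  rw [specRank, finrank_euclRange_eq_trace (specProj_mul_self A η), specProj_matAbs, trace_cfc]

theorem specRank_le (A : Matrix p q ℝ) (η : ℝ) : specRank A η ≤ Fintype.card q :=
  (Submodule.finrank_le _).trans (by simp)

variable {A : Matrix p q ℝ} {C : ℝ}

theorem eigenvalues_gram_mem_Icc (hC : ∀ i, ∑ j, |(A.transpose * A) i j| ≤ C) (j : q) :
    (posSemidef_gram A).1.eigenvalues j ∈ Set.Icc 0 C :=
  ⟨(posSemidef_gram A).eigenvalues_nonneg j,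
    (le_abs_self _).trans (abs_eigenvalues_le (posSemidef_gram A).1 hC j)⟩

/-- Eigenvalue by eigenvalue: those with `√t ≤ η` contribute at most `1`, the others at most `(1 -
η²/C)^k`. The `max 0` keeps the base nonnegative when `η² > C`. -/
theorem trace_pow_le_specRank (hC0 : 0 < C) (hC : ∀ i, ∑ j, |(A.transpose * A) i j| ≤ C)
    {η : ℝ} (hη : 0 < η) (k : ℕ) :
    ((1 - C⁻¹ • (A.transpose * A)) ^ k).trace ≤
      (specRank A η : ℝ) + Fintype.card q * (max 0 (1 - η ^ 2 / C)) ^ k := by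
  rw [trace_one_sub_smul_pow, specRank_eq, ← Finset.card_univ, ← nsmul_eq_mul, ← Finset.sum_const,
    ← Finset.sum_add_distrib]
  refine Finset.sum_le_sum fun j _ => ?_
  obtain ⟨h0, h1⟩ := eigenvalues_gram_mem_Icc hC j
  set t := (posSemidef_gram A).1.eigenvalues j
  have h2 : C⁻¹ * t ≤ 1 := by rwa [inv_mul_le_iff₀ hC0, mul_one]
  have h3 : 0 ≤ C⁻¹ * t := by positivity
  by_cases h : Real.sqrt t ≤ η
  · have : cutoff η t = 1 :=
      Set.indicator_of_mem (show Real.sqrt t ∈ Set.Icc 0 η from ⟨Real.sqrt_nonneg _, h⟩) _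
    rw [this]
    have := pow_le_one₀ (n := k) (sub_nonneg.2 h2) (by linarith)
    have : 0 ≤ (max 0 (1 - η ^ 2 / C)) ^ k := by positivity
    linarith
  · have hc : cutoff η t = 0 := Set.indicator_of_notMem (fun h' => h h'.2) _
    rw [hc, zero_add]
    refine pow_le_pow_left₀ (sub_nonneg.2 h2) (le_max_of_le_right ?_) k
    have : η ^ 2 ≤ t := (Real.le_sqrt hη.le h0).1 (not_le.1 h).le
    rw [div_eq_inv_mul]
    have := mul_le_mul_of_nonneg_left this (inv_nonneg.2 hC0.le)
    linarith

/-- Each eigenvalue counted by the rank contributes at least `(1 - η²/C)^k` to the trace, and the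
remaining contributions are nonnegative. -/
theorem specRank_mul_le_trace_pow (hC0 : 0 < C) (hC : ∀ i, ∑ j, |(A.transpose * A) i j| ≤ C)
    {η : ℝ} (hη : 0 < η) (hη1 : η ^ 2 ≤ C) (k : ℕ) :
    specRank A η * (1 - η ^ 2 / C) ^ k ≤ ((1 - C⁻¹ • (A.transpose * A)) ^ k).trace := by
  rw [trace_one_sub_smul_pow, specRank_eq, Finset.sum_mul]
  refine Finset.sum_le_sum fun j _ => ?_
  obtain ⟨h0, h1⟩ := eigenvalues_gram_mem_Icc hC j
  set t := (posSemidef_gram A).1.eigenvalues j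
  have h2 : C⁻¹ * t ≤ 1 := by rwa [inv_mul_le_iff₀ hC0, mul_one]
  by_cases h : Real.sqrt t ≤ η
  · have : cutoff η t = 1 :=
      Set.indicator_of_mem (show Real.sqrt t ∈ Set.Icc 0 η from ⟨Real.sqrt_nonneg _, h⟩) _
    rw [this, one_mul]
    refine pow_le_pow_left₀ (sub_nonneg.2 ((div_le_one hC0).2 hη1)) ?_ k
    have : t ≤ η ^ 2 := (Real.sqrt_le_left hη.le).1 h
    rw [div_eq_inv_mul]
    have := mul_le_mul_of_nonneg_left this (inv_nonneg.2 hC0.le)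
    linarith
  · have hc : cutoff η t = 0 := Set.indicator_of_notMem (fun h' => h h'.2) _
    rw [hc, zero_mul]
    exact pow_nonneg (sub_nonneg.2 h2) k

theorem trace_pow_succ_le (hC0 : 0 < C) (hC : ∀ i, ∑ j, |(A.transpose * A) i j| ≤ C) (k : ℕ) :
    ((1 - C⁻¹ • (A.transpose * A)) ^ (k + 1)).trace ≤
      ((1 - C⁻¹ • (A.transpose * A)) ^ k).trace := by
  rw [trace_one_sub_smul_pow, trace_one_sub_smul_pow]
  refine Finset.sum_le_sum fun j _ => ?_
  obtain ⟨h0, h1⟩ := eigenvalues_gram_mem_Icc hC j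
  set t := (posSemidef_gram A).1.eigenvalues j
  have h2 : C⁻¹ * t ≤ 1 := by rwa [inv_mul_le_iff₀ hC0, mul_one]
  have h3 : 0 ≤ C⁻¹ * t := by positivity
  exact pow_le_pow_of_le_one (sub_nonneg.2 h2) (by linarith) k.le_succ

theorem trace_pow_nonneg (hC0 : 0 < C) (hC : ∀ i, ∑ j, |(A.transpose * A) i j| ≤ C) (k : ℕ) :
    0 ≤ ((1 - C⁻¹ • (A.transpose * A)) ^ k).trace := by
  rw [trace_one_sub_smul_pow]
  refine Finset.sum_nonneg fun j _ => pow_nonneg ?_ k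
  rw [sub_nonneg, inv_mul_le_iff₀ hC0, mul_one]
  exact (eigenvalues_gram_mem_Icc hC j).2

end Spectral

/-! ### Growth rates versus normalized ranks -/

section Growth

variable {Γ : Type*} [Group Γ] {d n m : ℕ} (σ : Γ → Equiv.Perm (Fin d))
  (f : Matrix (Fin n) (Fin m) (MonoidAlgebra ℝ Γ)) {ε η : ℝ}

theorem specProj_isHermitian {p q : Type*} [Fintype p] [Fintype q] [DecidableEq q]
    (A : Matrix p q ℝ) (η : ℝ) : (specProj η (matAbs A)).IsHermitian :=
  cfc_predicate (R := ℝ) (p := IsSelfAdjoint) _ (matAbs A)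

theorem specRank_div_le_growth (hd : 0 < d) (hε : 0 < ε) (hε1 : ε < 1) :
    (specRank (extendMat σ f) η : ℝ) / d ≤ growth σ f ε η := by
  have hP := specProj_mul_self (extendMat σ f) η
  have h := one_le_coveringNum_mul_pow hd _ hP
    (norm_mulVec_le_of_idempotent hP (specProj_isHermitian _ η)) hε
  have hl : 0 < Real.log (1 / ε) := Real.log_pos (by rw [lt_div_iff₀ hε]; linarith)
  have hd' : (0 : ℝ) < d := by exact_mod_cast hd
  rw [growth, div_le_div_iff₀ hd' (by positivity)]
  set N : ℝ := (coveringNum (fun ξ ζ => l2Norm (ξ - ζ)) ε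
    ((specProj η (matAbs (extendMat σ f))).mulVec '' l2Ball m d) : ℝ)
  have hle : (1 / ε) ^ specRank (extendMat σ f) η ≤ N := by
    rw [div_pow, one_pow, div_le_iff₀ (by positivity)]
    exact h
  have := Real.log_le_log (by positivity) hle
  rw [Real.log_pow] at this
  nlinarith

theorem growth_le (hd : 0 < d) (hε : 0 < ε) (hε1 : ε < 1) :
    growth σ f ε η ≤ (specRank (extendMat σ f) η : ℝ) / d + m * (Real.log 3 / Real.log (1 / ε)) := by
  have hP := specProj_mul_self (extendMat σ f) η
  have hc := norm_mulVec_le_of_idempotent hP (specProj_isHermitian (extendMat σ f) η)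
  have h := coveringNum_le_pow hd _ hP hc hε
  have h' := one_le_coveringNum_mul_pow hd _ hP hc hε
  have hl : 0 < Real.log (1 / ε) := Real.log_pos (by rw [lt_div_iff₀ hε]; linarith)
  have hd' : (0 : ℝ) < d := by exact_mod_cast hd
  have hr : (specRank (extendMat σ f) η : ℝ) ≤ m * d := by
    have := specRank_le (extendMat σ f) η
    rw [Fintype.card_prod, Fintype.card_fin, Fintype.card_fin] at this
    exact_mod_cast this
  rw [growth]
  set N : ℝ := (coveringNum (fun ξ ζ => l2Norm (ξ - ζ)) ε
    ((specProj η (matAbs (extendMat σ f))).mulVec '' l2Ball m d) : ℝ)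
  -- The lower covering bound excludes `N = 0`, as monotonicity of the logarithm requires.
  have hN : 0 < N := by
    by_contra hN
    have : N * ε ^ Module.finrank ℝ (euclRange (specProj η (matAbs (extendMat σ f)))) ≤ 0 :=
      mul_nonpos_of_nonpos_of_nonneg (not_lt.1 hN) (by positivity)
    linarith
  have h3 : (1 + 2 / ε) ≤ 3 * (1 / ε) := by
    have : 1 ≤ 1 / ε := by rw [le_div_iff₀ hε]; linarith
    have : 2 / ε = 2 * (1 / ε) := by ring
    linarith
  have hlog : Real.log N ≤ specRank (extendMat σ f) η * (Real.log 3 + Real.log (1 / ε)) := by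
    rw [← Real.log_mul (by norm_num) (by positivity), ← Real.log_pow]
    exact Real.log_le_log hN (h.trans (pow_le_pow_left₀ (by positivity) h3 _))
  -- The trivial bound `r ≤ m d` makes the error term independent of `d` and `η`.
  have h4 : Real.log 3 * specRank (extendMat σ f) η ≤ Real.log 3 * (m * d) :=
    mul_le_mul_of_nonneg_left hr (Real.log_nonneg (by norm_num))
  have h5 : (specRank (extendMat σ f) η : ℝ) / d + m * (Real.log 3 / Real.log (1 / ε)) =
      (specRank (extendMat σ f) η * Real.log (1 / ε) + Real.log 3 * (m * d)) /
        (d * Real.log (1 / ε)) := by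
    field_simp
  rw [h5]
  gcongr
  linarith

end Growth

/-! ### The entrywise `ℓ¹` norm and permutation matrices -/

/-- The entrywise `ℓ¹` norm. -/
def entrySum {d : ℕ} (X : Matrix (Fin d) (Fin d) ℝ) : ℝ := ∑ j, ∑ k, |X j k|

section EntrySum

variable {d : ℕ}

theorem entrySum_nonneg (X : Matrix (Fin d) (Fin d) ℝ) : 0 ≤ entrySum X :=
  Finset.sum_nonneg fun _ _ => Finset.sum_nonneg fun _ _ => abs_nonneg _

theorem entrySum_add_le (X Y : Matrix (Fin d) (Fin d) ℝ) :
    entrySum (X + Y) ≤ entrySum X + entrySum Y := by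
  simp only [entrySum, ← Finset.sum_add_distrib]
  exact Finset.sum_le_sum fun j _ => Finset.sum_le_sum fun k _ => abs_add_le _ _

theorem entrySum_smul (c : ℝ) (X : Matrix (Fin d) (Fin d) ℝ) :
    entrySum (c • X) = |c| * entrySum X := by
  simp [entrySum, Finset.mul_sum, abs_mul]

theorem entrySum_transpose (X : Matrix (Fin d) (Fin d) ℝ) :
    entrySum X.transpose = entrySum X := Finset.sum_comm

/-- After exchanging sums, the `l`-th absolute column sum of `X` multiplies the `l`-th absolute row
sum of `Y`. -/
theorem entrySum_mul_le (X Y : Matrix (Fin d) (Fin d) ℝ) {K : ℝ}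
    (hX : ∀ k, ∑ j, |X j k| ≤ K) : entrySum (X * Y) ≤ K * entrySum Y := by
  calc entrySum (X * Y) ≤ ∑ j, ∑ k, ∑ l, |X j l| * |Y l k| := by
        refine Finset.sum_le_sum fun j _ => Finset.sum_le_sum fun k _ => ?_
        rw [Matrix.mul_apply]
        refine (Finset.abs_sum_le_sum_abs _ _).trans_eq ?_
        simp [abs_mul]
    _ = ∑ l, (∑ j, |X j l|) * ∑ k, |Y l k| := by
        simp_rw [Finset.sum_mul_sum]
        exact (Finset.sum_congr rfl fun j _ => Finset.sum_comm).trans Finset.sum_comm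
    _ ≤ ∑ l, K * ∑ k, |Y l k| :=
        Finset.sum_le_sum fun l _ => mul_le_mul_of_nonneg_right (hX l)
          (Finset.sum_nonneg fun _ _ => abs_nonneg _)
    _ = K * entrySum Y := by rw [entrySum, Finset.mul_sum]

theorem entrySum_mul_le' (X Y : Matrix (Fin d) (Fin d) ℝ) {K : ℝ}
    (hY : ∀ j, ∑ k, |Y j k| ≤ K) : entrySum (X * Y) ≤ K * entrySum X := by
  rw [← entrySum_transpose, Matrix.transpose_mul, ← entrySum_transpose X]
  exact entrySum_mul_le _ _ hY

theorem abs_trace_le_entrySum (X : Matrix (Fin d) (Fin d) ℝ) : |X.trace| ≤ entrySum X :=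
  (Finset.abs_sum_le_sum_abs _ _).trans (Finset.sum_le_sum fun j _ =>
    Finset.single_le_sum (f := fun k => |X j k|) (fun _ _ => abs_nonneg _) (Finset.mem_univ j))

/-- Columns at which `p` and `q` agree cancel; every other column has just two nonzero entries, `1`
and `-1`. -/
theorem entrySum_permMat_sub_le (p q : Equiv.Perm (Fin d)) :
    entrySum (permMat p - permMat q) ≤ 2 * (Finset.univ.filter fun k => p k ≠ q k).card := by
  rw [← entrySum_transpose]
  calc entrySum (permMat p - permMat q).transpose
      ≤ ∑ k, if p k ≠ q k then (2 : ℝ) else 0 := by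
        refine Finset.sum_le_sum fun k _ => ?_
        by_cases h : p k = q k
        · simp [permMat, h]
        · rw [if_pos h]
          calc ∑ j, |(permMat p - permMat q) j k|
              ≤ ∑ j, ((if p k = j then (1 : ℝ) else 0) + if q k = j then 1 else 0) := by
                refine Finset.sum_le_sum fun j _ => ?_
                simp only [permMat, Matrix.sub_apply, Matrix.of_apply]
                split_ifs <;> norm_num
            _ = 2 := by simp [Finset.sum_add_distrib]; norm_num
    _ = _ := by rw [← Finset.sum_filter, Finset.sum_const, nsmul_eq_mul, mul_comm]

theorem permMat_mul (p q : Equiv.Perm (Fin d)) : permMat p * permMat q = permMat (p * q) := by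
  ext j k
  simp [permMat, Matrix.mul_apply]
  rfl

theorem permMat_one : permMat (1 : Equiv.Perm (Fin d)) = 1 := by
  ext j k
  simp [permMat, Matrix.one_apply, eq_comm]

theorem permMat_transpose (p : Equiv.Perm (Fin d)) : (permMat p).transpose = permMat p⁻¹ := by
  ext j k
  simp only [permMat, Matrix.transpose_apply, Matrix.of_apply]
  congr 1
  rw [Equiv.Perm.inv_eq_iff_eq, eq_comm (a := k)]

theorem trace_permMat (p : Equiv.Perm (Fin d)) :
    (permMat p).trace = (Finset.univ.filter fun k => p k = k).card := by
  simp [permMat, Matrix.trace]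

end EntrySum

/-! ### Linear extension to the group ring, and its involution -/

section Extend

variable {Γ : Type*} [Group Γ] {d : ℕ} (σ : Γ → Equiv.Perm (Fin d))

theorem extend_eq_linearCombination (a : MonoidAlgebra ℝ Γ) :
    extend σ a = Finsupp.linearCombination ℝ (fun g => permMat (σ g)) a.coeff := rfl

theorem extend_add (a b : MonoidAlgebra ℝ Γ) : extend σ (a + b) = extend σ a + extend σ b := by
  simp [extend_eq_linearCombination]

theorem extend_zero : extend σ (0 : MonoidAlgebra ℝ Γ) = 0 := by
  simp [extend_eq_linearCombination]

theorem extend_smul (c : ℝ) (a : MonoidAlgebra ℝ Γ) : extend σ (c • a) = c • extend σ a := by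
  simp [extend_eq_linearCombination]

theorem extend_single (g : Γ) (r : ℝ) :
    extend σ (MonoidAlgebra.single g r) = r • permMat (σ g) := by
  simp [extend_eq_linearCombination]

end Extend

/-- The involution `∑ a(g) g ↦ ∑ a(g) g⁻¹` of the real group ring. -/
def involute {Γ : Type*} [Group Γ] (a : MonoidAlgebra ℝ Γ) : MonoidAlgebra ℝ Γ :=
  MonoidAlgebra.mapDomain (fun g : Γ => g⁻¹) a

section Involute

variable {Γ : Type*} [Group Γ]

theorem involute_add (a b : MonoidAlgebra ℝ Γ) :
    involute (a + b) = involute a + involute b := MonoidAlgebra.mapDomain_add _ _ _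

theorem involute_zero : involute (0 : MonoidAlgebra ℝ Γ) = 0 := MonoidAlgebra.mapDomain_zero _

theorem involute_single (g : Γ) (r : ℝ) :
    involute (MonoidAlgebra.single g r) = MonoidAlgebra.single g⁻¹ r :=
  MonoidAlgebra.mapDomain_single

/-- The adjoint of a matrix over the real group ring. -/
def adjointMat {n m : ℕ} (f : Matrix (Fin n) (Fin m) (MonoidAlgebra ℝ Γ)) :
    Matrix (Fin m) (Fin n) (MonoidAlgebra ℝ Γ) := f.transpose.map involute

/-- The matrix `1 - c f^* f`. -/
def oneSubGram {n m : ℕ} (c : ℝ) (f : Matrix (Fin n) (Fin m) (MonoidAlgebra ℝ Γ)) :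
    Matrix (Fin m) (Fin m) (MonoidAlgebra ℝ Γ) := 1 - c • (adjointMat f * f)

end Involute

/-! ### Bounded and null sequences: the null ones absorb bounded factors on both sides -/

section Sequences

variable {d : ℕ → ℕ}

/-- Row and column `ℓ¹` norms are uniformly bounded. -/
def IsBddSeq (X : ∀ i, Matrix (Fin (d i)) (Fin (d i)) ℝ) : Prop :=
  ∃ K, ∀ i, (∀ j, ∑ k, |X i j k| ≤ K) ∧ ∀ k, ∑ j, |X i j k| ≤ K

/-- The normalized entrywise `ℓ¹` norm tends to `0`. -/
def IsNullSeq (X : ∀ i, Matrix (Fin (d i)) (Fin (d i)) ℝ) : Prop :=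
  Tendsto (fun i => entrySum (X i) / d i) atTop (𝓝 0)

variable {X Y : ∀ i, Matrix (Fin (d i)) (Fin (d i)) ℝ}

theorem IsBddSeq.add (hX : IsBddSeq X) (hY : IsBddSeq Y) : IsBddSeq fun i => X i + Y i := by
  obtain ⟨K, hK⟩ := hX
  obtain ⟨L, hL⟩ := hY
  refine ⟨K + L, fun i => ⟨fun j => ?_, fun k => ?_⟩⟩
  · refine le_trans ?_ (add_le_add ((hK i).1 j) ((hL i).1 j))
    rw [← Finset.sum_add_distrib]
    exact Finset.sum_le_sum fun k _ => abs_add_le _ _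
  · refine le_trans ?_ (add_le_add ((hK i).2 k) ((hL i).2 k))
    rw [← Finset.sum_add_distrib]
    exact Finset.sum_le_sum fun k _ => abs_add_le _ _

theorem IsBddSeq.smul (c : ℝ) (hX : IsBddSeq X) : IsBddSeq fun i => c • X i := by
  obtain ⟨K, hK⟩ := hX
  refine ⟨|c| * K, fun i => ⟨fun j => ?_, fun k => ?_⟩⟩
  · simpa [abs_mul, Finset.mul_sum] using mul_le_mul_of_nonneg_left ((hK i).1 j) (abs_nonneg c)
  · simpa [abs_mul, Finset.mul_sum] using mul_le_mul_of_nonneg_left ((hK i).2 k) (abs_nonneg c)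

theorem IsBddSeq.transpose (hX : IsBddSeq X) : IsBddSeq fun i => (X i).transpose :=
  hX.imp fun _ h i => ⟨(h i).2, (h i).1⟩

theorem sum_abs_mul_le {d : ℕ} {X Y : Matrix (Fin d) (Fin d) ℝ} {K L : ℝ} (hL0 : 0 ≤ L)
    (hX : ∀ j, ∑ k, |X j k| ≤ K) (hY : ∀ j, ∑ k, |Y j k| ≤ L) (j : Fin d) :
    ∑ k, |(X * Y) j k| ≤ K * L := by
  calc ∑ k, |(X * Y) j k| ≤ ∑ k, ∑ l, |X j l| * |Y l k| := by
        refine Finset.sum_le_sum fun k _ => ?_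
        rw [Matrix.mul_apply]
        refine (Finset.abs_sum_le_sum_abs _ _).trans_eq ?_
        simp [abs_mul]
    _ = ∑ l, |X j l| * ∑ k, |Y l k| := by
        rw [Finset.sum_comm]
        simp_rw [Finset.mul_sum]
    _ ≤ ∑ l, |X j l| * L :=
        Finset.sum_le_sum fun l _ => mul_le_mul_of_nonneg_left (hY l) (abs_nonneg _)
    _ ≤ K * L := by
        rw [← Finset.sum_mul]
        exact mul_le_mul_of_nonneg_right (hX j) hL0

theorem IsBddSeq.mul (hX : IsBddSeq X) (hY : IsBddSeq Y) : IsBddSeq fun i => X i * Y i := by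
  obtain ⟨K, hK⟩ := hX
  obtain ⟨L, hL⟩ := hY
  have hK' : ∀ i, (∀ j, ∑ k, |X i j k| ≤ max K 0) ∧ ∀ k, ∑ j, |X i j k| ≤ max K 0 := fun i =>
    ⟨fun j => ((hK i).1 j).trans (le_max_left _ _), fun j => ((hK i).2 j).trans (le_max_left _ _)⟩
  have hL' : ∀ i, (∀ j, ∑ k, |Y i j k| ≤ max L 0) ∧ ∀ k, ∑ j, |Y i j k| ≤ max L 0 := fun i =>
    ⟨fun j => ((hL i).1 j).trans (le_max_left _ _), fun j => ((hL i).2 j).trans (le_max_left _ _)⟩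
  refine ⟨max K 0 * max L 0, fun i => ⟨fun j => ?_, fun k => ?_⟩⟩
  · exact sum_abs_mul_le (le_max_right _ _) (hK' i).1 (hL' i).1 j
  · have := sum_abs_mul_le (X := (Y i).transpose) (Y := (X i).transpose) (le_max_right K 0)
      (hL' i).2 (hK' i).2 k
    rw [← Matrix.transpose_mul, mul_comm] at this
    exact this

theorem isBddSeq_permMat (p : ∀ i, Equiv.Perm (Fin (d i))) : IsBddSeq fun i => permMat (p i) := by
  have h : ∀ i (q : Equiv.Perm (Fin (d i))) k, ∑ j, |permMat q j k| ≤ 1 := by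
    intro i q k
    simp [permMat, apply_ite abs]
  refine ⟨1, fun i => ⟨fun j => ?_, h i (p i)⟩⟩
  have := h i (p i)⁻¹ j
  rw [← permMat_transpose] at this
  exact this

theorem isBddSeq_zero : IsBddSeq fun i => (0 : Matrix (Fin (d i)) (Fin (d i)) ℝ) :=
  ⟨0, fun _ => by simp⟩

theorem isNullSeq_zero : IsNullSeq fun i => (0 : Matrix (Fin (d i)) (Fin (d i)) ℝ) := by
  simp [IsNullSeq, entrySum]

theorem IsNullSeq.of_le {u : ℕ → ℝ} (hu : Tendsto u atTop (𝓝 0))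
    (h : ∀ i, entrySum (X i) / d i ≤ u i) : IsNullSeq X :=
  squeeze_zero (fun _ => div_nonneg (entrySum_nonneg _) (Nat.cast_nonneg _)) h hu

theorem IsNullSeq.add (hX : IsNullSeq X) (hY : IsNullSeq Y) : IsNullSeq fun i => X i + Y i :=
  .of_le (by simpa using Tendsto.add hX hY) fun i => by
    rw [← add_div]
    gcongr
    exact entrySum_add_le _ _

theorem IsNullSeq.smul (c : ℝ) (hX : IsNullSeq X) : IsNullSeq fun i => c • X i :=
  .of_le (by simpa using Tendsto.const_mul |c| hX) fun i => by
    rw [entrySum_smul, mul_div_assoc]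

theorem IsNullSeq.mul_left (hX : IsBddSeq X) (hY : IsNullSeq Y) : IsNullSeq fun i => X i * Y i := by
  obtain ⟨K, hK⟩ := hX
  refine .of_le (by simpa using Tendsto.const_mul K hY) fun i => ?_
  rw [← mul_div_assoc]
  gcongr
  exact entrySum_mul_le _ _ (hK i).2

theorem IsNullSeq.mul_right (hX : IsNullSeq X) (hY : IsBddSeq Y) :
    IsNullSeq fun i => X i * Y i := by
  obtain ⟨K, hK⟩ := hY
  refine .of_le (by simpa using Tendsto.const_mul K hX) fun i => ?_
  rw [← mul_div_assoc]
  gcongr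
  exact entrySum_mul_le' _ _ (hK i).1

theorem IsNullSeq.transpose (hX : IsNullSeq X) : IsNullSeq fun i => (X i).transpose := by
  simpa only [IsNullSeq, entrySum_transpose] using hX

theorem IsNullSeq.tendsto_trace (hX : IsNullSeq X) :
    Tendsto (fun i => (X i).trace / d i) atTop (𝓝 0) := by
  refine squeeze_zero_norm (fun i => ?_) hX
  rw [Real.norm_eq_abs, abs_div, Nat.abs_cast]
  gcongr
  exact abs_trace_le_entrySum _

/-- Converts agreement of permutations at almost all points, the form of the multiplicativity
hypothesis, into a matrix estimate. -/
theorem isNullSeq_permMat_sub (p q : ∀ i, Equiv.Perm (Fin (d i))) (hd : Tendsto d atTop atTop)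
    (h : Tendsto (fun i => ((Finset.univ.filter fun k => p i k = q i k).card : ℝ) / (d i : ℝ))
      atTop (𝓝 1)) : IsNullSeq fun i => permMat (p i) - permMat (q i) := by
  have h1 : Tendsto (fun i => 2 * (1 - ((Finset.univ.filter fun k => p i k = q i k).card : ℝ) /
      (d i : ℝ))) atTop (𝓝 0) := by
    simpa using (h.const_sub 1).const_mul 2
  refine squeeze_zero' (.of_forall fun i => div_nonneg (entrySum_nonneg _) (Nat.cast_nonneg _))
    ?_ h1
  filter_upwards [hd.eventually_gt_atTop 0] with i hi
  have hi' : (0 : ℝ) < d i := by exact_mod_cast hi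
  have hcard := Finset.card_filter_add_card_filter_not (s := (Finset.univ : Finset (Fin (d i))))
    (fun k => p i k = q i k)
  rw [Finset.card_univ, Fintype.card_fin] at hcard
  have hcard' : (((Finset.univ.filter fun k => p i k = q i k).card : ℝ)) +
    (Finset.univ.filter fun k => p i k ≠ q i k).card = d i := by exact_mod_cast hcard
  have := entrySum_permMat_sub_le (p i) (q i)
  rw [div_le_iff₀ hi', mul_assoc, sub_mul, one_mul, div_mul_cancel₀ _ hi'.ne']
  linarith

end Sequences

/-! ### Asymptotic models of group ring elements and convergence of moments -/

section Model

variable {Γ : Type*} [Group Γ] {d : ℕ → ℕ} {σ : (i : ℕ) → Γ → Equiv.Perm (Fin (d i))}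

theorem isBddSeq_extend (σ : (i : ℕ) → Γ → Equiv.Perm (Fin (d i))) (a : MonoidAlgebra ℝ Γ) :
    IsBddSeq fun i => extend (σ i) a := by
  induction a using MonoidAlgebra.induction_linear with
  | zero => simpa only [extend_zero] using isBddSeq_zero
  | add a b ha hb => simpa only [extend_add] using ha.add hb
  | single g r =>
    simpa only [extend_single] using (isBddSeq_permMat fun i => σ i g).smul r

theorem IsSoficApprox.isNullSeq_mul (hσ : IsSoficApprox d σ) (g h : Γ) :
    IsNullSeq fun i => permMat (σ i g) * permMat (σ i h) - permMat (σ i (g * h)) := by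
  simp only [permMat_mul]
  exact isNullSeq_permMat_sub _ _ hσ.tendsto_atTop (hσ.mul g h)

/-- `σ i 1` need not be the identity, but by injectivity `σ i 1 (σ i 1 k) = σ i 1 k` holds exactly
when `k` is fixed. -/
theorem IsSoficApprox.isNullSeq_one (hσ : IsSoficApprox d σ) :
    IsNullSeq fun i => permMat (σ i 1) - 1 := by
  have h : IsNullSeq fun i => permMat (σ i 1) - permMat 1 :=
    isNullSeq_permMat_sub _ _ hσ.tendsto_atTop ((hσ.mul 1 1).congr fun i =>
      congrArg (fun s : Finset (Fin (d i)) => (s.card : ℝ) / d i) (by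
        ext k
        simp only [Finset.mem_filter_univ, mul_one, EmbeddingLike.apply_eq_iff_eq]
        rfl))
  simpa only [permMat_one] using h

theorem IsSoficApprox.isNullSeq_extend_mul (hσ : IsSoficApprox d σ) (a b : MonoidAlgebra ℝ Γ) :
    IsNullSeq fun i => extend (σ i) a * extend (σ i) b - extend (σ i) (a * b) := by
  induction a using MonoidAlgebra.induction_linear with
  | zero => simpa [extend_zero] using isNullSeq_zero
  | add a a' ha ha' =>
    convert ha.add ha' using 2
    rw [add_mul, extend_add, extend_add, add_mul]
    abel
  | single g r =>
    induction b using MonoidAlgebra.induction_linear with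
    | zero => simpa [extend_zero] using isNullSeq_zero
    | add a a' ha ha' =>
      convert ha.add ha' using 2
      rw [mul_add, extend_add, extend_add, mul_add]
      abel
    | single h s =>
      convert (hσ.isNullSeq_mul g h).smul (r * s) using 2
      rw [MonoidAlgebra.single_mul_single, extend_single, extend_single, extend_single, smul_sub,
        smul_mul_smul_comm]

/-- Since `σ(g) σ(g⁻¹)` is close to `σ(1)`, hence to `1`, multiplying by the bounded matrix of
`σ(g)⁻¹`, which is the transpose, gives the claim. -/
theorem IsSoficApprox.isNullSeq_transpose_permMat (hσ : IsSoficApprox d σ) (g : Γ) :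
    IsNullSeq fun i => (permMat (σ i g)).transpose - permMat (σ i g⁻¹) := by
  have h1 := (hσ.isNullSeq_mul g g⁻¹).add (by simpa using hσ.isNullSeq_one)
  have h2 := (IsNullSeq.mul_left (isBddSeq_permMat fun i => (σ i g)⁻¹) h1).smul (-1)
  convert h2 using 2 with i
  rw [mul_inv_cancel, sub_add_sub_cancel, mul_sub, ← mul_assoc, permMat_mul, inv_mul_cancel,
    permMat_one, one_mul, mul_one, permMat_transpose]
  simp

theorem IsSoficApprox.isNullSeq_transpose_extend (hσ : IsSoficApprox d σ)
    (a : MonoidAlgebra ℝ Γ) :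
    IsNullSeq fun i => (extend (σ i) a).transpose - extend (σ i) (involute a) := by
  induction a using MonoidAlgebra.induction_linear with
  | zero => simpa [extend_zero, involute_zero] using isNullSeq_zero
  | add a a' ha ha' =>
    convert ha.add ha' using 2
    rw [involute_add, extend_add, extend_add, Matrix.transpose_add]
    abel
  | single g r =>
    convert (hσ.isNullSeq_transpose_permMat g).smul r using 2
    rw [involute_single, extend_single, extend_single, smul_sub, Matrix.transpose_smul]

/-- The trace counts fixed points of `σ i g`. Such a point is either moved by `σ i 1`, or is one
where `σ i g` and `σ i 1` agree; the former are rare by multiplicativity, the latter by freeness. -/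
theorem IsSoficApprox.tendsto_trace_permMat (hσ : IsSoficApprox d σ) {g : Γ} (hg : g ≠ 1) :
    Tendsto (fun i => (permMat (σ i g)).trace / d i) atTop (𝓝 0) := by
  have h1 : Tendsto (fun i =>
      (1 - ((Finset.univ.filter fun k => σ i g k ≠ σ i 1 k).card : ℝ) / (d i : ℝ)) +
      (1 - ((Finset.univ.filter fun k => σ i 1 (σ i 1 k) = σ i (1 * 1) k).card : ℝ) / (d i : ℝ)))
      atTop (𝓝 0) := by
    simpa using ((hσ.free g 1 hg).const_sub 1).add ((hσ.mul 1 1).const_sub 1)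
  refine squeeze_zero' (.of_forall fun i => ?_) ?_ h1
  · rw [trace_permMat]
    positivity
  filter_upwards [hσ.tendsto_atTop.eventually_gt_atTop 0] with i hi
  have hi' : (0 : ℝ) < d i := by exact_mod_cast hi
  have hc1 := Finset.card_filter_add_card_filter_not (s := (Finset.univ : Finset (Fin (d i))))
    (fun k => σ i g k ≠ σ i 1 k)
  have hc2 := Finset.card_filter_add_card_filter_not (s := (Finset.univ : Finset (Fin (d i))))
    (fun k => σ i 1 (σ i 1 k) = σ i (1 * 1) k)
  rw [Finset.card_univ, Fintype.card_fin] at hc1 hc2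
  have hle : (Finset.univ.filter fun k => σ i g k = k).card ≤
      (Finset.univ.filter fun k => ¬ (σ i g k ≠ σ i 1 k)).card +
      (Finset.univ.filter fun k => ¬ (σ i 1 (σ i 1 k) = σ i (1 * 1) k)).card := by
    refine le_trans (Finset.card_le_card ?_) (Finset.card_union_le _ _)
    intro k hk
    simp only [Finset.mem_filter, Finset.mem_univ, true_and, Finset.mem_union, mul_one,
      EmbeddingLike.apply_eq_iff_eq, not_not] at hk ⊢
    by_cases h : σ i 1 k = k
    · exact Or.inl (hk.trans h.symm)
    · exact Or.inr h
  rw [trace_permMat, div_le_iff₀ hi', add_mul, sub_mul, sub_mul, one_mul,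
    div_mul_cancel₀ _ hi'.ne', div_mul_cancel₀ _ hi'.ne']
  have hc1' : (((Finset.univ.filter fun k => σ i g k ≠ σ i 1 k).card : ℝ)) +
    (Finset.univ.filter fun k => ¬ (σ i g k ≠ σ i 1 k)).card = d i := by exact_mod_cast hc1
  have hc2' : (((Finset.univ.filter fun k => σ i 1 (σ i 1 k) = σ i (1 * 1) k).card : ℝ)) +
    (Finset.univ.filter fun k => ¬ (σ i 1 (σ i 1 k) = σ i (1 * 1) k)).card = d i := by
    exact_mod_cast hc2
  have hle' : ((Finset.univ.filter fun k => σ i g k = k).card : ℝ) ≤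
      (Finset.univ.filter fun k => ¬ (σ i g k ≠ σ i 1 k)).card +
      (Finset.univ.filter fun k => ¬ (σ i 1 (σ i 1 k) = σ i (1 * 1) k)).card := by
    exact_mod_cast hle
  linarith

theorem IsSoficApprox.tendsto_trace_permMat_one (hσ : IsSoficApprox d σ) :
    Tendsto (fun i => (permMat (σ i 1)).trace / d i) atTop (𝓝 1) := by
  have h := hσ.isNullSeq_one.tendsto_trace.add_const 1
  rw [zero_add] at h
  refine h.congr' ?_
  filter_upwards [hσ.tendsto_atTop.eventually_gt_atTop 0] with i hi
  have hi' : (d i : ℝ) ≠ 0 := by exact_mod_cast hi.ne'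
  rw [Matrix.trace_sub, Matrix.trace_one, Fintype.card_fin, sub_div, div_self hi', sub_add_cancel]

theorem IsSoficApprox.tendsto_trace_extend (hσ : IsSoficApprox d σ) (a : MonoidAlgebra ℝ Γ) :
    Tendsto (fun i => (extend (σ i) a).trace / d i) atTop (𝓝 (a.coeff 1)) := by
  classical
  induction a using MonoidAlgebra.induction_linear with
  | zero => simp [extend_zero]
  | add a b ha hb => simpa [extend_add, add_div] using ha.add hb
  | single g r =>
    simp only [extend_single, Matrix.trace_smul, smul_eq_mul, mul_div_assoc,
      MonoidAlgebra.coeff_single]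
    by_cases hg : g = 1
    · subst hg
      simpa using hσ.tendsto_trace_permMat_one.const_mul r
    · simpa [Finsupp.single_apply, hg] using (hσ.tendsto_trace_permMat hg).const_mul r

/-- The bounded sequence of matrices `X` is asymptotically equal to `extend (σ i) a`. -/
structure IsModel (σ : (i : ℕ) → Γ → Equiv.Perm (Fin (d i))) (a : MonoidAlgebra ℝ Γ)
    (X : ∀ i, Matrix (Fin (d i)) (Fin (d i)) ℝ) : Prop where
  bdd : IsBddSeq X
  close : IsNullSeq fun i => X i - extend (σ i) a

variable {a b : MonoidAlgebra ℝ Γ} {X Y : ∀ i, Matrix (Fin (d i)) (Fin (d i)) ℝ}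

theorem isModel_extend (σ : (i : ℕ) → Γ → Equiv.Perm (Fin (d i))) (a : MonoidAlgebra ℝ Γ) :
    IsModel σ a fun i => extend (σ i) a :=
  ⟨isBddSeq_extend σ a, by simpa only [sub_self] using isNullSeq_zero⟩

theorem isModel_zero (σ : (i : ℕ) → Γ → Equiv.Perm (Fin (d i))) :
    IsModel σ 0 fun _ => 0 := by
  simpa only [extend_zero] using isModel_extend σ 0

theorem IsSoficApprox.isModel_one (hσ : IsSoficApprox d σ) : IsModel σ 1 fun _ => 1 := by
  refine ⟨by simpa only [permMat_one] using isBddSeq_permMat (d := d) fun _ => 1, ?_⟩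
  convert hσ.isNullSeq_one.smul (-1) using 2
  rw [MonoidAlgebra.one_def, extend_single]
  simp

theorem IsModel.add (hX : IsModel σ a X) (hY : IsModel σ b Y) :
    IsModel σ (a + b) fun i => X i + Y i := by
  refine ⟨hX.bdd.add hY.bdd, ?_⟩
  convert hX.close.add hY.close using 2
  rw [extend_add]
  abel

theorem IsModel.smul (c : ℝ) (hX : IsModel σ a X) : IsModel σ (c • a) fun i => c • X i := by
  refine ⟨hX.bdd.smul c, ?_⟩
  convert hX.close.smul c using 2
  rw [extend_smul, smul_sub]

theorem IsModel.sub (hX : IsModel σ a X) (hY : IsModel σ b Y) :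
    IsModel σ (a - b) fun i => X i - Y i := by
  simpa [sub_eq_add_neg] using hX.add (hY.smul (-1))

/-- Telescoping: `XY - σ(ab) = (X - σ(a))Y + σ(a)(Y - σ(b)) + (σ(a)σ(b) - σ(ab))`, where boundedness
of `Y` and `σ(a)` keeps the first two terms null. -/
theorem IsModel.mul (hσ : IsSoficApprox d σ) (hX : IsModel σ a X) (hY : IsModel σ b Y) :
    IsModel σ (a * b) fun i => X i * Y i := by
  refine ⟨hX.bdd.mul hY.bdd, ?_⟩
  convert ((hX.close.mul_right hY.bdd).add
    (IsNullSeq.mul_left (isBddSeq_extend σ a) hY.close)).add (hσ.isNullSeq_extend_mul a b) using 2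
  noncomm_ring

theorem IsModel.transpose (hσ : IsSoficApprox d σ) (hX : IsModel σ a X) :
    IsModel σ (involute a) fun i => (X i).transpose := by
  refine ⟨hX.bdd.transpose, ?_⟩
  convert hX.close.transpose.add (hσ.isNullSeq_transpose_extend a) using 2
  rw [Matrix.transpose_sub, sub_add_sub_cancel]

theorem IsModel.sum {ι : Type*} (s : Finset ι) {a : ι → MonoidAlgebra ℝ Γ}
    {X : ι → ∀ i, Matrix (Fin (d i)) (Fin (d i)) ℝ} (h : ∀ l ∈ s, IsModel σ (a l) (X l)) :
    IsModel σ (∑ l ∈ s, a l) fun i => ∑ l ∈ s, X l i := by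
  classical
  induction s using Finset.induction_on with
  | empty => simpa using isModel_zero σ
  | insert l s hl ih =>
    simp only [Finset.sum_insert hl]
    exact (h l (Finset.mem_insert_self _ _)).add
      (ih fun l' hl' => h l' (Finset.mem_insert_of_mem hl'))

theorem IsModel.tendsto_trace (hσ : IsSoficApprox d σ) (hX : IsModel σ a X) :
    Tendsto (fun i => (X i).trace / d i) atTop (𝓝 (a.coeff 1)) := by
  have := hX.close.tendsto_trace.add (hσ.tendsto_trace_extend a)
  rw [zero_add] at this
  refine this.congr fun i => ?_
  rw [← add_div, ← Matrix.trace_add, sub_add_cancel]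

/-- Entrywise version of `IsModel` for matrices over the group ring. -/
def IsMatModel {n m : ℕ} (σ : (i : ℕ) → Γ → Equiv.Perm (Fin (d i)))
    (f : Matrix (Fin n) (Fin m) (MonoidAlgebra ℝ Γ))
    (F : ∀ i, Matrix (Fin n) (Fin m) (Matrix (Fin (d i)) (Fin (d i)) ℝ)) : Prop :=
  ∀ j l, IsModel σ (f j l) fun i => F i j l

theorem IsMatModel.mul {n m r : ℕ} (hσ : IsSoficApprox d σ)
    {f : Matrix (Fin n) (Fin m) (MonoidAlgebra ℝ Γ)}
    {g : Matrix (Fin m) (Fin r) (MonoidAlgebra ℝ Γ)}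
    {F : ∀ i, Matrix (Fin n) (Fin m) (Matrix (Fin (d i)) (Fin (d i)) ℝ)}
    {G : ∀ i, Matrix (Fin m) (Fin r) (Matrix (Fin (d i)) (Fin (d i)) ℝ)}
    (hF : IsMatModel σ f F) (hG : IsMatModel σ g G) :
    IsMatModel σ (f * g) fun i => F i * G i := fun j l => by
  simp only [Matrix.mul_apply]
  exact IsModel.sum _ fun k _ => (hF j k).mul hσ (hG k l)

theorem IsMatModel.pow {m : ℕ} (hσ : IsSoficApprox d σ)
    {f : Matrix (Fin m) (Fin m) (MonoidAlgebra ℝ Γ)}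
    {F : ∀ i, Matrix (Fin m) (Fin m) (Matrix (Fin (d i)) (Fin (d i)) ℝ)}
    (hF : IsMatModel σ f F) (k : ℕ) : IsMatModel σ (f ^ k) fun i => F i ^ k := by
  induction k with
  | zero =>
    intro j l
    simp only [pow_zero, Matrix.one_apply]
    split_ifs
    exacts [hσ.isModel_one, isModel_zero σ]
  | succ k ih => simpa only [pow_succ] using ih.mul hσ hF

variable {n m : ℕ} (f : Matrix (Fin n) (Fin m) (MonoidAlgebra ℝ Γ))

/-- The block matrix of `σ(f)ᵀ σ(f)`. -/
def gramBlock {d : ℕ} (σ : Γ → Equiv.Perm (Fin d)) :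
    Matrix (Fin m) (Fin m) (Matrix (Fin d) (Fin d) ℝ) :=
  (f.map (extend σ)).transpose.map Matrix.transpose * f.map (extend σ)

theorem comp_gramBlock {d : ℕ} (σ : Γ → Equiv.Perm (Fin d)) :
    Matrix.compRingEquiv (Fin m) (Fin d) ℝ (gramBlock f σ) =
      (extendMat σ f).transpose * extendMat σ f := by
  ext ⟨j, k⟩ ⟨l, k'⟩
  rw [Matrix.compRingEquiv_apply, Matrix.comp_apply, gramBlock, Matrix.mul_apply, Matrix.sum_apply,
    Matrix.mul_apply, Fintype.sum_prod_type]
  rfl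

theorem isMatModel_gramBlock (hσ : IsSoficApprox d σ) :
    IsMatModel σ (adjointMat f * f) fun i => gramBlock f (σ i) :=
  IsMatModel.mul hσ (fun j l => (isModel_extend σ (f l j)).transpose hσ)
    fun j l => isModel_extend σ (f j l)

/-- The point is that `C` does not depend on `i`: each of the finitely many blocks has uniformly
bounded row sums. With Gershgorin this puts all the spectra in one interval `[0, C]`. -/
theorem exists_sum_abs_gram_le (hσ : IsSoficApprox d σ) : ∃ C, ∀ i j,
    ∑ k, |((extendMat (σ i) f).transpose * extendMat (σ i) f) j k| ≤ C := by
  choose K hK using fun j l => (isMatModel_gramBlock f hσ j l).bdd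
  refine ⟨∑ j, ∑ l, max (K j l) 0, fun i j => ?_⟩
  rw [← comp_gramBlock, Fintype.sum_prod_type]
  refine (Finset.sum_le_sum fun l _ => ((hK j.1 l i).1 j.2).trans (le_max_left _ 0)).trans ?_
  exact Finset.single_le_sum (f := fun j => ∑ l, max (K j l) 0)
    (fun _ _ => Finset.sum_nonneg fun _ _ => le_max_right _ _) (Finset.mem_univ j.1)

theorem trace_compRingEquiv {d : ℕ} (F : Matrix (Fin m) (Fin m) (Matrix (Fin d) (Fin d) ℝ)) :
    (Matrix.compRingEquiv (Fin m) (Fin d) ℝ F).trace = ∑ j, (F j j).trace := by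
  simp only [Matrix.trace, Fintype.sum_prod_type]
  rfl

/-- The moments of `σ_i(f)ᵀ σ_i(f)` converge to those of `f^* f`. -/
theorem IsSoficApprox.tendsto_trace_pow (hσ : IsSoficApprox d σ)
    (f : Matrix (Fin n) (Fin m) (MonoidAlgebra ℝ Γ)) (c : ℝ) (k : ℕ) :
    Tendsto (fun i =>
      ((1 - c • ((extendMat (σ i) f).transpose * extendMat (σ i) f)) ^ k).trace / (d i : ℝ)) atTop
      (𝓝 (∑ j, ((oneSubGram c f ^ k) j j).coeff 1)) := by
  have h1 : IsMatModel σ (oneSubGram c f) fun i => 1 - c • gramBlock f (σ i) := by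
    intro j l
    refine IsModel.sub ?_ ((isMatModel_gramBlock f hσ j l).smul c)
    simp only [Matrix.one_apply]
    split_ifs
    exacts [hσ.isModel_one, isModel_zero σ]
  have h2 := tendsto_finsetSum Finset.univ fun j _ => (h1.pow hσ k j j).tendsto_trace hσ
  refine h2.congr fun i => ?_
  rw [← Finset.sum_div, ← trace_compRingEquiv, map_pow, map_sub, map_one, ← comp_gramBlock]
  rfl

end Model

/-! ### The right regular representation as a `*`-homomorphism -/

section RightRegular

variable {Γ : Type*} [Group Γ]

theorem rightReg_apply (g : Γ) (ξ : Ell2 Γ) (x : Γ) : rightReg g ξ x = ξ (x * g) := rfl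

theorem rightReg_one : rightReg (1 : Γ) = 1 := by
  ext ξ x
  simp [rightReg_apply]

theorem rightReg_mul (g h : Γ) : rightReg (g * h) = rightReg g * rightReg h := by
  ext ξ x
  simp [rightReg_apply, mul_assoc]

theorem inner_rightReg (g : Γ) (ξ ζ : Ell2 Γ) :
    ⟪rightReg g ξ, ζ⟫_ℂ = ⟪ξ, rightReg g⁻¹ ζ⟫_ℂ := by
  rw [lp.inner_eq_tsum, lp.inner_eq_tsum,
    ← (Equiv.mulRight g).tsum_eq fun x => ⟪ξ x, rightReg g⁻¹ ζ x⟫_ℂ]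
  simp [rightReg_apply]

theorem rightRegAlg_eq_sum (a : MonoidAlgebra ℝ Γ) :
    rightRegAlg a = a.coeff.sum fun g r => (r : ℂ) • rightReg g := rfl

theorem rightRegAlg_add (a b : MonoidAlgebra ℝ Γ) :
    rightRegAlg (a + b) = rightRegAlg a + rightRegAlg b := by
  classical
  simp only [rightRegAlg_eq_sum, MonoidAlgebra.coeff_add]
  exact Finsupp.sum_add_index (by simp) (by simp [add_smul])

theorem rightRegAlg_zero : rightRegAlg (0 : MonoidAlgebra ℝ Γ) = 0 := by
  simp [rightRegAlg_eq_sum]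

theorem rightRegAlg_single (g : Γ) (r : ℝ) :
    rightRegAlg (MonoidAlgebra.single g r) = (r : ℂ) • rightReg g :=
  (rightRegAlg_eq_sum _).trans (Finsupp.sum_single_index (by rw [Complex.ofReal_zero, zero_smul]))

theorem rightRegAlg_one : rightRegAlg (1 : MonoidAlgebra ℝ Γ) = 1 := by
  rw [MonoidAlgebra.one_def, rightRegAlg_single, rightReg_one]
  simp

theorem rightRegAlg_smul (c : ℝ) (a : MonoidAlgebra ℝ Γ) :
    rightRegAlg (c • a) = (c : ℂ) • rightRegAlg a := by
  induction a using MonoidAlgebra.induction_linear with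
  | zero => simp [rightRegAlg_zero]
  | add a b ha hb => rw [smul_add, rightRegAlg_add, ha, hb, rightRegAlg_add, smul_add]
  | single g r =>
    rw [MonoidAlgebra.smul_single, rightRegAlg_single, rightRegAlg_single, smul_smul, smul_eq_mul,
      Complex.ofReal_mul]

theorem rightRegAlg_mul (a b : MonoidAlgebra ℝ Γ) :
    rightRegAlg (a * b) = rightRegAlg a * rightRegAlg b := by
  induction a using MonoidAlgebra.induction_linear with
  | zero => simp [rightRegAlg_zero]
  | add a a' ha ha' => rw [add_mul, rightRegAlg_add, ha, ha', rightRegAlg_add, add_mul]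
  | single g r =>
    induction b using MonoidAlgebra.induction_linear with
    | zero => simp [rightRegAlg_zero]
    | add b b' hb hb' => rw [mul_add, rightRegAlg_add, hb, hb', rightRegAlg_add, mul_add]
    | single h s =>
      rw [MonoidAlgebra.single_mul_single, rightRegAlg_single, rightRegAlg_single,
        rightRegAlg_single, rightReg_mul, smul_mul_smul_comm, Complex.ofReal_mul]

theorem rightRegAlg_sum {ι : Type*} (s : Finset ι) (a : ι → MonoidAlgebra ℝ Γ) :
    rightRegAlg (∑ l ∈ s, a l) = ∑ l ∈ s, rightRegAlg (a l) :=
  map_sum (⟨⟨rightRegAlg, rightRegAlg_zero⟩, rightRegAlg_add⟩ : MonoidAlgebra ℝ Γ →+ _) a s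

theorem inner_rightRegAlg (a : MonoidAlgebra ℝ Γ) (ξ ζ : Ell2 Γ) :
    ⟪rightRegAlg a ξ, ζ⟫_ℂ = ⟪ξ, rightRegAlg (involute a) ζ⟫_ℂ := by
  induction a using MonoidAlgebra.induction_linear with
  | zero => simp [rightRegAlg_zero, involute_zero]
  | add a b ha hb =>
    simp only [involute_add, rightRegAlg_add, add_apply, inner_add_left,
      inner_add_right, ha, hb]
  | single g r =>
    simp only [involute_single, rightRegAlg_single, smul_apply,
      inner_smul_left, inner_smul_right, inner_rightReg, Complex.conj_ofReal]

/-- The bridge between the two sides: the coefficient at the identity is also the limit of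
normalized traces in `IsSoficApprox.tendsto_trace_extend`. -/
theorem inner_deltaOne_rightRegAlg (a : MonoidAlgebra ℝ Γ) :
    ⟪deltaOne Γ, rightRegAlg a (deltaOne Γ)⟫_ℂ = (a.coeff 1 : ℂ) := by
  classical
  induction a using MonoidAlgebra.induction_linear with
  | zero => simp [rightRegAlg_zero]
  | add a b ha hb =>
    simp [rightRegAlg_add, ha, hb]
  | single g r =>
    rw [rightRegAlg_single, smul_apply, inner_smul_right, deltaOne,
      lp.inner_single_left, rightReg_apply]
    by_cases hg : g = 1 <;> simp [hg, lp.single_apply]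

variable {n m r : ℕ}

theorem rightRegMat_apply (f : Matrix (Fin n) (Fin m) (MonoidAlgebra ℝ Γ)) (ξ : Ell2Sum Γ m)
    (j : Fin n) : rightRegMat f ξ j = ∑ l, rightRegAlg (f j l) (ξ l) := by
  simp [rightRegMat]

theorem rightRegMat_mul (f : Matrix (Fin n) (Fin m) (MonoidAlgebra ℝ Γ))
    (g : Matrix (Fin m) (Fin r) (MonoidAlgebra ℝ Γ)) :
    rightRegMat (f * g) = (rightRegMat f).comp (rightRegMat g) := by
  refine ContinuousLinearMap.ext fun ξ => PiLp.ext fun j => ?_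
  simp only [rightRegMat_apply, ContinuousLinearMap.comp_apply, Matrix.mul_apply, rightRegAlg_sum,
    rightRegAlg_mul, map_sum, sum_apply, mul_apply_eq_comp]
  exact Finset.sum_comm

theorem rightRegMat_one : rightRegMat (1 : Matrix (Fin m) (Fin m) (MonoidAlgebra ℝ Γ)) = 1 := by
  refine ContinuousLinearMap.ext fun ξ => PiLp.ext fun j => ?_
  rw [rightRegMat_apply, Finset.sum_eq_single j]
  · simp [rightRegAlg_one]
  · intro l _ hl
    simp [Matrix.one_apply_ne hl.symm, rightRegAlg_zero]
  · simp

theorem rightRegMat_sub (f g : Matrix (Fin n) (Fin m) (MonoidAlgebra ℝ Γ)) :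
    rightRegMat (f - g) = rightRegMat f - rightRegMat g := by
  have h : ∀ a b : MonoidAlgebra ℝ Γ, rightRegAlg (a - b) = rightRegAlg a - rightRegAlg b :=
    fun a b => eq_sub_of_add_eq (by rw [← rightRegAlg_add, sub_add_cancel])
  refine ContinuousLinearMap.ext fun ξ => PiLp.ext fun j => ?_
  simp [rightRegMat_apply, h]

theorem rightRegMat_smul (c : ℝ) (f : Matrix (Fin n) (Fin m) (MonoidAlgebra ℝ Γ)) :
    rightRegMat (c • f) = (c : ℂ) • rightRegMat f := by
  refine ContinuousLinearMap.ext fun ξ => PiLp.ext fun j => ?_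
  rw [smul_apply, PiLp.smul_apply, rightRegMat_apply, rightRegMat_apply, Finset.smul_sum]
  simp only [Matrix.smul_apply, rightRegAlg_smul, smul_apply]

theorem rightRegMat_pow (f : Matrix (Fin m) (Fin m) (MonoidAlgebra ℝ Γ)) (k : ℕ) :
    rightRegMat (f ^ k) = rightRegMat f ^ k := by
  induction k with
  | zero => rw [pow_zero, pow_zero, rightRegMat_one]
  | succ k ih => rw [pow_succ, pow_succ, rightRegMat_mul, ih]; rfl

theorem inner_rightRegMat (f : Matrix (Fin n) (Fin m) (MonoidAlgebra ℝ Γ)) (ξ : Ell2Sum Γ m)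
    (ζ : Ell2Sum Γ n) : ⟪rightRegMat f ξ, ζ⟫_ℂ = ⟪ξ, rightRegMat (adjointMat f) ζ⟫_ℂ := by
  simp only [PiLp.inner_apply, rightRegMat_apply, sum_inner, inner_sum, inner_rightRegAlg]
  exact Finset.sum_comm

theorem rightRegMat_adjointMat (f : Matrix (Fin n) (Fin m) (MonoidAlgebra ℝ Γ)) :
    rightRegMat (adjointMat f) = ContinuousLinearMap.adjoint (rightRegMat f) :=
  (ContinuousLinearMap.eq_adjoint_iff _ _).2 fun ξ ζ => by
    rw [← inner_conj_symm, ← inner_rightRegMat, inner_conj_symm]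

theorem vnTrace_rightRegMat (f : Matrix (Fin m) (Fin m) (MonoidAlgebra ℝ Γ)) :
    vnTrace (rightRegMat f) = ∑ j, ((f j j).coeff 1 : ℂ) := by
  refine Finset.sum_congr rfl fun j _ => ?_
  rw [opEntry, rightRegMat_apply, Finset.sum_eq_single j]
  · simp [inner_deltaOne_rightRegAlg]
  · intro l _ hl
    simp [hl]
  · simp

end RightRegular

/-! ### The mean ergodic theorem and the dimension of the kernel -/

section Ergodic

variable {Γ : Type*} [Group Γ] {m : ℕ}

theorem vnTrace_sum {ι : Type*} (s : Finset ι) (T : ι → Ell2Sum Γ m →L[ℂ] Ell2Sum Γ m) :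
    vnTrace (∑ k ∈ s, T k) = ∑ k ∈ s, vnTrace (T k) := by
  simp only [vnTrace, opEntry]
  rw [Finset.sum_comm]
  refine Finset.sum_congr rfl fun j _ => ?_
  rw [sum_apply, WithLp.ofLp_sum, Finset.sum_apply, inner_sum]

theorem vnTrace_smul (c : ℂ) (T : Ell2Sum Γ m →L[ℂ] Ell2Sum Γ m) :
    vnTrace (c • T) = c * vnTrace T := by
  simp [vnTrace, opEntry, Finset.mul_sum]

/-- Pointwise convergence suffices because the trace is a finite sum of matrix coefficients. -/
theorem tendsto_vnTrace {ι : Type*} {l : Filter ι} {T : ι → Ell2Sum Γ m →L[ℂ] Ell2Sum Γ m}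
    {S : Ell2Sum Γ m →L[ℂ] Ell2Sum Γ m} (h : ∀ ξ, Tendsto (fun i => T i ξ) l (𝓝 (S ξ))) :
    Tendsto (fun i => vnTrace (T i)) l (𝓝 (vnTrace S)) := by
  refine tendsto_finsetSum _ fun j _ => ?_
  exact tendsto_const_nhds.inner (((PiLp.continuous_apply 2 _ j).tendsto _).comp (h _))

/-- The averaged traces of the powers of a contraction converge to the dimension of its space of
fixed vectors. -/
theorem tendsto_cesaro_vnTrace (B : Ell2Sum Γ m →L[ℂ] Ell2Sum Γ m) (hB : ‖B‖ ≤ 1)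
    (K : Submodule ℂ (Ell2Sum Γ m)) [K.HasOrthogonalProjection] (hK : ∀ ξ, ξ ∈ K ↔ B ξ = ξ) :
    Tendsto (fun N : ℕ => (N : ℝ)⁻¹ * ∑ k ∈ Finset.range N, (vnTrace (B ^ k)).re) atTop
      (𝓝 (vnDim K)) := by
  have hKe : B.eqLocus (1 : Ell2Sum Γ m →L[ℂ] Ell2Sum Γ m) = K := by
    ext ξ
    exact (hK ξ).symm
  subst hKe
  -- Von Neumann's mean ergodic theorem for the contraction `B`.
  have h1 : ∀ ξ, Tendsto (fun N : ℕ => ((N : ℂ)⁻¹ • ∑ k ∈ Finset.range N, B ^ k) ξ) atTop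
      (𝓝 ((B.eqLocus (1 : Ell2Sum Γ m →L[ℂ] Ell2Sum Γ m)).starProjection ξ)) := by
    intro ξ
    have h := B.tendsto_birkhoffAverage_orthogonalProjection hB ξ
    refine h.congr fun N => ?_
    simp [birkhoffAverage, birkhoffSum]
  have h2 := (Complex.continuous_re.tendsto _).comp (tendsto_vnTrace h1)
  refine h2.congr fun N => ?_
  rw [Function.comp_apply, vnTrace_smul, vnTrace_sum, ← Complex.ofReal_natCast,
    ← Complex.ofReal_inv, Complex.re_ofReal_mul, Complex.re_sum]

/-- With `c = C⁻¹`, expanding gives `‖x - cT*Tx‖² = ‖x‖² - 2c‖Tx‖² + c²‖T*Tx‖²`, and the last term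
is at most `c‖Tx‖²`. -/
theorem norm_one_sub_smul_adjoint_comp_le {E F : Type*} [NormedAddCommGroup E]
    [InnerProductSpace ℂ E] [CompleteSpace E] [NormedAddCommGroup F] [InnerProductSpace ℂ F]
    [CompleteSpace F] (T : E →L[ℂ] F) {C : ℝ} (hC0 : 0 < C) (hC : ‖T‖ ^ 2 ≤ C) :
    ‖(1 : E →L[ℂ] E) - ((C⁻¹ : ℝ) : ℂ) • (ContinuousLinearMap.adjoint T).comp T‖ ≤ 1 := by
  refine ContinuousLinearMap.opNorm_le_bound _ zero_le_one fun x => ?_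
  rw [one_mul]
  refine le_of_sq_le_sq ?_ (norm_nonneg _)
  have h1 : ‖ContinuousLinearMap.adjoint T (T x)‖ ^ 2 ≤ C * ‖T x‖ ^ 2 := by
    have := (ContinuousLinearMap.adjoint T).le_opNorm (T x)
    rw [LinearIsometryEquiv.norm_map] at this
    calc _ ≤ (‖T‖ * ‖T x‖) ^ 2 := pow_le_pow_left₀ (norm_nonneg _) this 2
      _ = ‖T‖ ^ 2 * ‖T x‖ ^ 2 := mul_pow _ _ _
      _ ≤ _ := mul_le_mul_of_nonneg_right hC (sq_nonneg _)
  have h2 : ((1 : E →L[ℂ] E) - ((C⁻¹ : ℝ) : ℂ) • (ContinuousLinearMap.adjoint T).comp T) x =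
      x - ((C⁻¹ : ℝ) : ℂ) • ContinuousLinearMap.adjoint T (T x) := rfl
  rw [h2, norm_sub_sq (𝕜 := ℂ), inner_smul_right, ContinuousLinearMap.adjoint_inner_right,
    norm_smul, mul_pow, inner_self_eq_norm_sq_to_K]
  have h3 : RCLike.re (((C⁻¹ : ℝ) : ℂ) * ((‖T x‖ : ℝ) : ℂ) ^ 2) = C⁻¹ * ‖T x‖ ^ 2 := by
    rw [← Complex.ofReal_pow, ← Complex.ofReal_mul]
    exact Complex.ofReal_re _
  have h4 : ‖((C⁻¹ : ℝ) : ℂ)‖ = C⁻¹ := by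
    rw [Complex.norm_real, Real.norm_of_nonneg (inv_nonneg.2 hC0.le)]
  erw [h3]
  rw [h4]
  have h5 : C⁻¹ ^ 2 * ‖ContinuousLinearMap.adjoint T (T x)‖ ^ 2 ≤ C⁻¹ * ‖T x‖ ^ 2 := by
    calc _ ≤ C⁻¹ ^ 2 * (C * ‖T x‖ ^ 2) := by gcongr
      _ = C⁻¹ * ‖T x‖ ^ 2 := by field_simp
  have h6 : 0 ≤ C⁻¹ * ‖T x‖ ^ 2 := by positivity
  linarith

/-- The fixed vectors of `1 - C⁻¹ T*T` form `ker T*T = ker T`, here with `T = ρ(f)`. -/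
theorem tendsto_cesaro_trace_oneSubGram {n : ℕ} (f : Matrix (Fin n) (Fin m) (MonoidAlgebra ℝ Γ))
    {C : ℝ} (hC0 : 0 < C) (hC : ‖rightRegMat f‖ ^ 2 ≤ C) :
    Tendsto (fun N : ℕ => (N : ℝ)⁻¹ * ∑ k ∈ Finset.range N,
      ∑ j, ((oneSubGram C⁻¹ f ^ k) j j).coeff 1) atTop (𝓝 (vnDim (rightRegMat f).ker)) := by
  have hB : rightRegMat (oneSubGram C⁻¹ f) =
      1 - ((C⁻¹ : ℝ) : ℂ) • (ContinuousLinearMap.adjoint (rightRegMat f)).comp (rightRegMat f) := by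
    rw [oneSubGram, rightRegMat_sub, rightRegMat_one, rightRegMat_smul, rightRegMat_mul,
      rightRegMat_adjointMat]
  have h := tendsto_cesaro_vnTrace (rightRegMat (oneSubGram C⁻¹ f))
    (hB ▸ norm_one_sub_smul_adjoint_comp_le _ hC0 hC) (rightRegMat f).ker fun ξ => ?_
  · refine h.congr fun N => ?_
    congr 1
    refine Finset.sum_congr rfl fun k _ => ?_
    rw [← rightRegMat_pow, vnTrace_rightRegMat, Complex.re_sum]
    simp
  · have hc : ((C⁻¹ : ℝ) : ℂ) ≠ 0 := by exact_mod_cast (inv_pos.2 hC0).ne'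
    have h2 : rightRegMat (oneSubGram C⁻¹ f) ξ =
        ξ - ((C⁻¹ : ℝ) : ℂ) • ContinuousLinearMap.adjoint (rightRegMat f) (rightRegMat f ξ) := by
      rw [hB]
      rfl
    rw [h2, sub_eq_self, smul_eq_zero_iff_right hc, LinearMap.mem_ker]
    constructor
    · intro h
      have h' : rightRegMat f ξ = 0 := h
      rw [h', map_zero]
    · intro h
      have h3 := ContinuousLinearMap.adjoint_inner_right (rightRegMat f) ξ (rightRegMat f ξ)
      rw [h, inner_zero_right] at h3
      exact inner_self_eq_zero.1 h3.symm

end Ergodic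

/-! ### Passage to the limit -/

section Limits

variable {Γ : Type*} [Group Γ] {d : ℕ → ℕ} {σ : (i : ℕ) → Γ → Equiv.Perm (Fin (d i))}
  {n m : ℕ} (f : Matrix (Fin n) (Fin m) (MonoidAlgebra ℝ Γ))

/-- The `k`-th moment of `1 - C⁻¹ f^* f` for the von Neumann trace. -/
def moment (C : ℝ) (k : ℕ) : ℝ := ∑ j, ((oneSubGram C⁻¹ f ^ k) j j).coeff 1

variable {f} {C : ℝ}

/-- Monotonicity is inherited from the matrix traces, so no functional calculus on `ℓ²(Γ)` is
needed. -/
theorem IsSoficApprox.antitone_moment (hσ : IsSoficApprox d σ) (hC0 : 0 < C)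
    (hC : ∀ i j, ∑ k, |((extendMat (σ i) f).transpose * extendMat (σ i) f) j k| ≤ C) :
    Antitone (moment f C) :=
  antitone_nat_of_succ_le fun k =>
    le_of_tendsto_of_tendsto' (hσ.tendsto_trace_pow f C⁻¹ (k + 1)) (hσ.tendsto_trace_pow f C⁻¹ k)
      fun i => div_le_div_of_nonneg_right (trace_pow_succ_le hC0 (hC i) k) (Nat.cast_nonneg _)

theorem IsSoficApprox.moment_nonneg (hσ : IsSoficApprox d σ) (hC0 : 0 < C)
    (hC : ∀ i j, ∑ k, |((extendMat (σ i) f).transpose * extendMat (σ i) f) j k| ≤ C) (k : ℕ) :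
    0 ≤ moment f C k :=
  ge_of_tendsto' (hσ.tendsto_trace_pow f C⁻¹ k) fun i =>
    div_nonneg (trace_pow_nonneg hC0 (hC i) k) (Nat.cast_nonneg _)

/-- A decreasing sequence bounded below converges, and its limit must be that of its Cesàro means.
-/
theorem IsSoficApprox.tendsto_moment (hσ : IsSoficApprox d σ) (hC0 : 0 < C)
    (hC : ∀ i j, ∑ k, |((extendMat (σ i) f).transpose * extendMat (σ i) f) j k| ≤ C)
    (hC' : ‖rightRegMat f‖ ^ 2 ≤ C) :
    Tendsto (moment f C) atTop (𝓝 (vnDim (rightRegMat f).ker)) := by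
  have h := tendsto_atTop_ciInf (hσ.antitone_moment hC0 hC)
    ⟨0, Set.forall_mem_range.2 (hσ.moment_nonneg hC0 hC)⟩
  rwa [tendsto_nhds_unique h.cesaro (tendsto_cesaro_trace_oneSubGram f hC0 hC')] at h

theorem IsSoficApprox.vnDim_le_moment (hσ : IsSoficApprox d σ) (hC0 : 0 < C)
    (hC : ∀ i j, ∑ k, |((extendMat (σ i) f).transpose * extendMat (σ i) f) j k| ≤ C)
    (hC' : ‖rightRegMat f‖ ^ 2 ≤ C) (k : ℕ) : vnDim (rightRegMat f).ker ≤ moment f C k :=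
  (hσ.antitone_moment hC0 hC).le_of_tendsto (hσ.tendsto_moment hC0 hC hC') k

theorem IsSoficApprox.exists_bound (hσ : IsSoficApprox d σ)
    (f : Matrix (Fin n) (Fin m) (MonoidAlgebra ℝ Γ)) : ∃ C : ℝ, 0 < C ∧
    (∀ i j, ∑ k, |((extendMat (σ i) f).transpose * extendMat (σ i) f) j k| ≤ C) ∧
    ‖rightRegMat f‖ ^ 2 ≤ C := by
  obtain ⟨C, hC⟩ := exists_sum_abs_gram_le f hσ
  -- The `+ 1` keeps the constant positive even when `ρ(f) = 0`.
  refine ⟨max C (‖rightRegMat f‖ ^ 2 + 1), ?_, fun i j => (hC i j).trans (le_max_left _ _), ?_⟩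
  · exact lt_max_of_lt_right (by positivity)
  · exact le_max_of_le_right (by linarith)

/-- The normalized ranks of the spectral projections are asymptotically at least `dim ker ρ(f)`. -/
theorem IsSoficApprox.eventually_le_specRank (hσ : IsSoficApprox d σ)
    (f : Matrix (Fin n) (Fin m) (MonoidAlgebra ℝ Γ)) {η δ : ℝ} (hη : 0 < η) (hδ : 0 < δ) :
    ∀ᶠ i in atTop, vnDim (rightRegMat f).ker - δ ≤
      (specRank (extendMat (σ i) f) η : ℝ) / d i := by
  obtain ⟨C, hC0, hC, hC'⟩ := hσ.exists_bound f
  have hq : max 0 (1 - η ^ 2 / C) < 1 := max_lt one_pos (by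
    have : 0 < η ^ 2 / C := by positivity
    linarith)
  have h1 : Tendsto (fun k => (m : ℝ) * max 0 (1 - η ^ 2 / C) ^ k) atTop (𝓝 0) := by
    simpa using (tendsto_pow_atTop_nhds_zero_of_lt_one (le_max_left _ _) hq).const_mul (m : ℝ)
  -- Here `η` is given and `k` is chosen so that eigenvalues above the cutoff cost less than `δ/2`.
  obtain ⟨k, hk⟩ := (h1.eventually_lt_const (half_pos hδ)).exists
  have h2 := (hσ.tendsto_trace_pow f C⁻¹ k).eventually_const_lt
    (show moment f C k - δ / 2 < _ by rw [moment]; linarith)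
  filter_upwards [h2, hσ.tendsto_atTop.eventually_gt_atTop 0] with i hi hdi
  have hd : (0 : ℝ) < d i := by exact_mod_cast hdi
  have h3 := trace_pow_le_specRank hC0 (hC i) hη k
  rw [Fintype.card_prod, Fintype.card_fin, Fintype.card_fin, Nat.cast_mul] at h3
  have h4 := div_le_div_of_nonneg_right h3 hd.le
  rw [add_div, mul_right_comm, mul_div_cancel_right₀ _ hd.ne'] at h4
  have h5 := hσ.vnDim_le_moment hC0 hC hC' k
  linarith

theorem specRank_div_le {d : ℕ} (A : Matrix (Fin n × Fin d) (Fin m × Fin d) ℝ) (η : ℝ)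
    (hd : 0 < d) : (specRank A η : ℝ) / d ≤ m := by
  have := specRank_le A η
  rw [Fintype.card_prod, Fintype.card_fin, Fintype.card_fin] at this
  rw [div_le_iff₀ (by exact_mod_cast hd)]
  exact_mod_cast this

/-- For small `η` the normalized ranks of the spectral projections are asymptotically at most
`dim ker ρ(f) + δ`. -/
theorem IsSoficApprox.exists_eventually_specRank_le (hσ : IsSoficApprox d σ)
    (f : Matrix (Fin n) (Fin m) (MonoidAlgebra ℝ Γ)) {δ : ℝ} (hδ : 0 < δ) :
    ∃ η : ℝ, 0 < η ∧ ∀ᶠ i in atTop, (specRank (extendMat (σ i) f) η : ℝ) / d i ≤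
      vnDim (rightRegMat f).ker + δ := by
  obtain ⟨C, hC0, hC, hC'⟩ := hσ.exists_bound f
  obtain ⟨k, hk⟩ := ((hσ.tendsto_moment hC0 hC hC').eventually_lt_const
    (show vnDim (rightRegMat f).ker < vnDim (rightRegMat f).ker + δ / 3 by linarith)).exists
  -- The order is now reversed: `k` is already fixed by the moments, and `η` is taken small
  -- depending on it.
  have h1 : Tendsto (fun η : ℝ => (m : ℝ) * (1 - (1 - η ^ 2 / C) ^ k)) (𝓝[>] 0) (𝓝 0) := by
    have hc : Continuous fun η : ℝ => (m : ℝ) * (1 - (1 - η ^ 2 / C) ^ k) := by fun_prop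
    simpa using (hc.tendsto 0).mono_left nhdsWithin_le_nhds
  have h2 : Tendsto (fun η : ℝ => η ^ 2) (𝓝[>] 0) (𝓝 0) := by
    simpa using ((continuous_pow 2).tendsto (0 : ℝ)).mono_left nhdsWithin_le_nhds
  obtain ⟨η, hη1, hη2, hη⟩ := ((h1.eventually_lt_const (show 0 < δ / 3 by positivity)).and
    ((h2.eventually_lt_const hC0).and (eventually_mem_nhdsWithin (a := (0 : ℝ))))).exists
  have hη0 : 0 < η := hη
  refine ⟨η, hη0, ?_⟩
  have h3 := (hσ.tendsto_trace_pow f C⁻¹ k).eventually_lt_const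
    (show _ < moment f C k + δ / 3 by rw [moment]; linarith)
  filter_upwards [h3, hσ.tendsto_atTop.eventually_gt_atTop 0] with i hi hdi
  have hd : (0 : ℝ) < d i := by exact_mod_cast hdi
  have h4 := div_le_div_of_nonneg_right (specRank_mul_le_trace_pow hC0 (hC i) hη0 hη2.le k) hd.le
  rw [mul_div_right_comm] at h4
  have hp : (1 - η ^ 2 / C) ^ k ≤ 1 := by
    refine pow_le_one₀ ?_ ?_
    · rw [sub_nonneg, div_le_one hC0]
      exact hη2.le
    · have : 0 ≤ η ^ 2 / C := by positivity
      linarith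
  -- Writing `r/d` as `(r/d)(1 - η²/C)^k` plus the defect, the first term is below `D + 2δ/3` by the
  -- moment bound and the defect below `δ/3` because `r/d ≤ m`.
  have h5 := mul_le_mul_of_nonneg_right (specRank_div_le (extendMat (σ i) f) η hdi)
    (sub_nonneg.2 hp)
  nlinarith

theorem IsSoficApprox.vnDim_le_liminf_growth (hσ : IsSoficApprox d σ)
    (f : Matrix (Fin n) (Fin m) (MonoidAlgebra ℝ Γ)) {ε η : ℝ} (hε : 0 < ε) (hε1 : ε < 1)
    (hη : 0 < η) : ((vnDim (rightRegMat f).ker : ℝ) : EReal) ≤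
      liminf (fun i : ℕ => (growth (σ i) f ε η : EReal)) atTop := by
  refine EReal.ge_of_forall_gt_iff_ge.1 fun x hx => ?_
  have hx' : x < vnDim (rightRegMat f).ker := by exact_mod_cast hx
  refine le_liminf_of_le (h := ?_)
  filter_upwards [hσ.eventually_le_specRank f hη (sub_pos.2 hx'),
    hσ.tendsto_atTop.eventually_gt_atTop 0] with i hi hd
  have := specRank_div_le_growth (σ i) f (η := η) hd hε hε1
  rw [EReal.coe_le_coe_iff]
  linarith

/-- For small `η` and then small `ε`, the growth rate is asymptotically at most
`dim ker ρ(f) + δ`. -/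
theorem IsSoficApprox.exists_limsup_growth_le (hσ : IsSoficApprox d σ)
    (f : Matrix (Fin n) (Fin m) (MonoidAlgebra ℝ Γ)) {δ : ℝ} (hδ : 0 < δ) :
    ∃ η : ℝ, 0 < η ∧ ∀ᶠ ε in 𝓝[>] (0 : ℝ),
      limsup (fun i : ℕ => (growth (σ i) f ε η : EReal)) atTop ≤
        ((vnDim (rightRegMat f).ker + δ : ℝ) : EReal) := by
  obtain ⟨η, hη, h⟩ := hσ.exists_eventually_specRank_le f (half_pos hδ)
  refine ⟨η, hη, ?_⟩
  have hlog : Tendsto (fun ε : ℝ => (m : ℝ) * (Real.log 3 / Real.log (1 / ε))) (𝓝[>] 0) (𝓝 0) := by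
    have h1 : Tendsto (fun ε : ℝ => Real.log (1 / ε)) (𝓝[>] 0) atTop := by
      simp only [one_div]
      exact Real.tendsto_log_atTop.comp tendsto_inv_nhdsGT_zero
    simpa using (h1.const_div_atTop (Real.log 3)).const_mul (m : ℝ)
  filter_upwards [hlog.eventually_lt_const (half_pos hδ),
    Ioo_mem_nhdsGT (one_pos : (0 : ℝ) < 1)] with ε hε1 hε
  refine limsup_le_of_le (h := ?_)
  filter_upwards [h, hσ.tendsto_atTop.eventually_gt_atTop 0] with i hi hd
  have := growth_le (σ i) f (η := η) hd hε.1 hε.2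
  rw [EReal.coe_le_coe_iff]
  linarith

/-- If `inf_η liminf_i` of a family is eventually at least `D`, and `limsup_i` is eventually at most
`D + δ` for suitable `η`, then all iterated limits equal `D`. -/
theorem iterated_limits_eq (G : ℝ → ℝ → ℕ → EReal) (D : ℝ)
    (hlow : ∀ᶠ ε in 𝓝[>] (0 : ℝ), ∀ η : {η : ℝ // 0 < η}, (D : EReal) ≤ liminf (G ε η) atTop)
    (hupp : ∀ δ : ℝ, 0 < δ → ∃ η : ℝ, 0 < η ∧
      ∀ᶠ ε in 𝓝[>] (0 : ℝ), limsup (G ε η) atTop ≤ ((D + δ : ℝ) : EReal)) :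
    liminf (fun ε : ℝ => ⨅ η : {η : ℝ // 0 < η}, liminf (G ε η) atTop) (𝓝[>] 0) = (D : EReal) ∧
    limsup (fun ε : ℝ => ⨅ η : {η : ℝ // 0 < η}, limsup (G ε η) atTop) (𝓝[>] 0) = (D : EReal) ∧
    (⨅ η : {η : ℝ // 0 < η}, liminf (fun ε : ℝ => liminf (G ε η) atTop) (𝓝[>] 0)) = (D : EReal) ∧
    (⨅ η : {η : ℝ // 0 < η}, limsup (fun ε : ℝ => limsup (G ε η) atTop) (𝓝[>] 0)) =
      (D : EReal) := by
  have hA : (D : EReal) ≤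
      liminf (fun ε : ℝ => ⨅ η : {η : ℝ // 0 < η}, liminf (G ε η) atTop) (𝓝[>] 0) :=
    le_liminf_of_le (h := hlow.mono fun _ => le_iInf)
  have hB : (D : EReal) ≤
      ⨅ η : {η : ℝ // 0 < η}, liminf (fun ε : ℝ => liminf (G ε η) atTop) (𝓝[>] 0) :=
    le_iInf fun η => le_liminf_of_le (h := hlow.mono fun _ h => h η)
  have hup : ∀ x : EReal, (∀ δ : ℝ, 0 < δ → x ≤ ((D + δ : ℝ) : EReal)) → x ≤ (D : EReal) := by
    intro x hx
    refine EReal.le_of_forall_lt_iff_le.1 fun z hz => ?_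
    have := hx (z - D) (sub_pos.2 (by exact_mod_cast hz))
    rwa [add_sub_cancel] at this
  have hC : limsup (fun ε : ℝ => ⨅ η : {η : ℝ // 0 < η}, limsup (G ε η) atTop) (𝓝[>] 0) ≤
      (D : EReal) := by
    refine hup _ fun δ hδ => ?_
    obtain ⟨η, hη, h⟩ := hupp δ hδ
    exact limsup_le_of_le (h := h.mono fun ε hε => iInf_le_of_le ⟨η, hη⟩ hε)
  have hD : (⨅ η : {η : ℝ // 0 < η}, limsup (fun ε : ℝ => limsup (G ε η) atTop) (𝓝[>] 0)) ≤
      (D : EReal) := by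
    refine hup _ fun δ hδ => ?_
    obtain ⟨η, hη, h⟩ := hupp δ hδ
    exact iInf_le_of_le ⟨η, hη⟩ (limsup_le_of_le (h := h))
  -- Each lower-limit expression is at most its upper-limit counterpart, so the bounds `hA`, `hB`
  -- below and `hC`, `hD` above close both pairs.
  have hle : ∀ (ε : ℝ) (η : {η : ℝ // 0 < η}), liminf (G ε η) atTop ≤ limsup (G ε η) atTop :=
    fun ε η => liminf_le_limsup
  have hAC : liminf (fun ε : ℝ => ⨅ η : {η : ℝ // 0 < η}, liminf (G ε η) atTop) (𝓝[>] 0) ≤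
      limsup (fun ε : ℝ => ⨅ η : {η : ℝ // 0 < η}, limsup (G ε η) atTop) (𝓝[>] 0) :=
    (liminf_le_limsup (by isBoundedDefault) (by isBoundedDefault)).trans
      (limsup_le_limsup (.of_forall fun ε => iInf_mono (hle ε)))
  have hBD : (⨅ η : {η : ℝ // 0 < η}, liminf (fun ε : ℝ => liminf (G ε η) atTop) (𝓝[>] 0)) ≤
      ⨅ η : {η : ℝ // 0 < η}, limsup (fun ε : ℝ => limsup (G ε η) atTop) (𝓝[>] 0) :=
    iInf_mono fun η => (liminf_le_limsup (by isBoundedDefault) (by isBoundedDefault)).trans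
      (limsup_le_limsup (.of_forall fun ε => hle ε η))
  exact ⟨le_antisymm (hAC.trans hC) hA, le_antisymm hC (hA.trans hAC),
    le_antisymm (hBD.trans hD) hB, le_antisymm hD (hB.trans hBD)⟩

end Limits

end SoficDim

end

/-! ### The dimension lemma -/

theorem lemma2p3 {Γ : Type*} [Group Γ] [Countable Γ]
    (d : ℕ → ℕ) (σ : (i : ℕ) → Γ → Equiv.Perm (Fin (d i)))
    (hσ : SoficDim.IsSoficApprox d σ)
    (n m : ℕ) (f : Matrix (Fin n) (Fin m) (MonoidAlgebra ℝ Γ)) :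
    liminf (fun ε : ℝ => ⨅ η : {η : ℝ // 0 < η},
        liminf (fun i : ℕ => (SoficDim.growth (σ i) f ε η : EReal)) atTop) (𝓝[>] 0)
      = ((SoficDim.vnDim ((SoficDim.rightRegMat f).ker) : ℝ) : EReal) ∧
    limsup (fun ε : ℝ => ⨅ η : {η : ℝ // 0 < η},
        limsup (fun i : ℕ => (SoficDim.growth (σ i) f ε η : EReal)) atTop) (𝓝[>] 0)
      = ((SoficDim.vnDim ((SoficDim.rightRegMat f).ker) : ℝ) : EReal) ∧
    (⨅ η : {η : ℝ // 0 < η}, liminf (fun ε : ℝ =>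
        liminf (fun i : ℕ => (SoficDim.growth (σ i) f ε η : EReal)) atTop) (𝓝[>] 0))
      = ((SoficDim.vnDim ((SoficDim.rightRegMat f).ker) : ℝ) : EReal) ∧
    (⨅ η : {η : ℝ // 0 < η}, limsup (fun ε : ℝ =>
        limsup (fun i : ℕ => (SoficDim.growth (σ i) f ε η : EReal)) atTop) (𝓝[>] 0))
      = ((SoficDim.vnDim ((SoficDim.rightRegMat f).ker) : ℝ) : EReal) := by
  refine SoficDim.iterated_limits_eq
    (fun ε η i => (SoficDim.growth (σ i) f ε η : EReal)) _ ?_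
    fun δ hδ => hσ.exists_limsup_growth_le f hδ
  -- Restricting to `ε < 1` makes the denominator `log (1/ε)` positive.
  filter_upwards [Ioo_mem_nhdsGT (one_pos : (0 : ℝ) < 1)] with ε hε η
  exact hσ.vnDim_le_liminf_growth f hε.1 hε.2 η.2
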